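/- **Setting and notation.** All balls $B_r(x)$ are open, and measures are Borel. Let $0<R\le\infty$ and let $\beta,\tau\ge 0$, $\Lambda\ge 1$ be finite. Let $(X,d,\mu)$ be a complete metric measure space in which all balls (of positive radius) have positive finite measure, and which is a PI space at scales $\le R$ with data $(\beta,\Lambda,\tau)$: for every $x\in X$ and every finite $0<r\le R$, $$\mu(B_{2r}(x))\le\beta\,\mu(B_r(x)),\qquad \int_{B_r(x)}|u-u_{x,r}|\,d\mu\le r\,\tau\int_{B_{\Lambda r}(x)}g\,d\mu$$ for every real function $u$ integrable on balls, with average $u_{x,r}$ over $B_r(x)$, and every upper gradient $g$ of $u$. Let $U\subset X$ be open and let $(Y,\nu)$ be a $\sigma$-finite measure space. For a map $h$ into a Banach space, $\operatorname{Lip}h(x)=\liminf_{r\to0}\sup_{d(x,x')<r}\|h(x)-h(x')\|/r$. For open $W$, $$\operatorname{VAR}(h,W)=\inf\,\liminf_i\int_W\operatorname{Lip}h_i\,d\mu$$ over all sequences of locally Lipschitz maps $h_i$ on $W$ with $h_i\to h$ in $L^1(W)$. The map $f$ belongs to $\operatorname{BV}(U,L^1(Y))$ if $f\in L^1(U,L^1(Y))$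 and $\operatorname{VAR}(f,U)<\infty$. A cut of $U$ is an element of $L^1(U)$ represented by the characteristic function of a set of finite measure. For $f\in L^1(U,L^1(Y))$ let $H\in L^1(U\times Y)$ and $g:Y\to L^1(U)$ be given by $H(x,\cdot)=f(x)$ and $g(y)=H(\cdot,y)$ almost everywhere. Let $\operatorname{Slice}(u,t)$ be $\{u\ge t\}$, $\emptyset$, $\{u\le t\}$ for $t>0$, $t=0$, $t<0$ respectively. The cut measure of $f$ is $\Sigma_f=\operatorname{Slice}_*(g_*\nu\times\mathcal L)$, where $\mathcal L$ is Lebesgue measure on $\mathbb R$. Its total perimeter measure is $\lambda_{\Sigma_f}(A)=\int\operatorname{Per}(E,U)(A)\,d\Sigma_f(E)$, where $\operatorname{Per}(E,U)$ is the perimeter measure of $E$: $\operatorname{Per}(E,U)(W)=\operatorname{VAR}(\chi_E,W)$ for open $W\subset U$, extended to all subsets of $U$ by outer regularity. **Proposition.** For all $\beta,\Lambda,\tau$ there is a constant $C<\infty$, depending only on $\beta,\Lambda,\tau$, such that for all $X,\mu,R,U,Y,\nu$ as above, every $f\in\operatorname{BV}(U,L^1(Y))$ and every $L\ge 0$: 1.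 If $f$ has an $L$-Lipschitz representative on $U$, or merely a representative that is $L$-Lipschitz on some neighbourhood of each point of $U$, then for all $x\in X$ and $r>0$, $$\lambda_{\Sigma_f}(B_r(x)\cap U)\le C L\,\mu(B_r(x)\cap U).$$ 2. Conversely, if $\lambda_{\Sigma_f}(B_r(x))\le L\,\mu(B_r(x))$ for every ball $B_r(x)\subset U$, then $f$ has a representative $F$ with the following properties: * $\|F(x)-F(y)\|_{L^1(Y)}\le C L\,d(x,y)$ for all $x,y\in U$ with $C\,d(x,y)\le R$ and $B_{C d(x,y)}(x)\subset U$; * $\|F(x)-F(y)\|_{L^1(Y)}\le C L\operatorname{length}(\gamma)$ for every curve $\gamma$ in $U$ from $x$ to $y$, i.e. $F$ is $CL$-Lipschitz for the inner length distance of $U$; * if any two points $x,y\in U$ are joined by a curve in $U$ of length at most $Q\,d(x,y)$, then $F$ is $CQL$-Lipschitz on $U$; * if $U=X$ and $R=\infty$, then $F$ is $CL$-Lipschitz on $X$. -/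

import Mathlib

open MeasureTheory Filter Topology Set Metric
open scoped ENNReal NNReal

noncomputable section

namespace TotalPerimeter

/-! ### PI spaces -/

/-- `g` is an upper gradient of the real function `f`: for every rectifiable curve
`c : [0, ℓ] → X` parametrized by arclength, `|f (c ℓ) - f (c 0)| ≤ ∫₀^ℓ g (c s) ds`. -/
def IsUpperGradient {X : Type*} [PseudoEMetricSpace X] [MeasurableSpace X]
    (g : X → ℝ≥0∞) (f : X → ℝ) : Prop :=
  Measurable g ∧ ∀ (ℓ : ℝ) (c : ℝ → X), 0 ≤ ℓ → HasUnitSpeedOn c (Icc 0 ℓ) →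
    edist (f (c ℓ)) (f (c 0)) ≤ ∫⁻ s in Icc 0 ℓ, g (c s)

/-- The doubling condition and the `(1,1)`-Poincaré inequality for all balls of radius at most `R`
(`R = ∞` is allowed), with doubling constant `β`, Poincaré constant `τ` and dilation `Λ`. Balls are
open, with positive and finite measure. A PI space is a *complete* metric space with such a
measure. -/
structure IsPIMeasure {X : Type*} [MetricSpace X] [MeasurableSpace X]
    (μ : Measure X) (R : ℝ≥0∞) (β Λ τ : ℝ≥0) : Prop where
  ball_pos : ∀ (x : X) (r : ℝ), 0 < r → 0 < μ (ball x r)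
  ball_lt_top : ∀ (x : X) (r : ℝ), μ (ball x r) < ∞
  doubling : ∀ (x : X) (r : ℝ), 0 < r → ENNReal.ofReal r ≤ R →
    μ (ball x (2 * r)) ≤ β * μ (ball x r)
  poincare : ∀ (f : X → ℝ) (g : X → ℝ≥0∞), (∀ x r, IntegrableOn f (ball x r) μ) →
    IsUpperGradient g f → ∀ (x : X) (r : ℝ), 0 < r → ENNReal.ofReal r ≤ R →
    ∫⁻ z in ball x r, ‖f z - ⨍ w in ball x r, f w ∂μ‖ₑ ∂μ
      ≤ ENNReal.ofReal r * τ * ∫⁻ z in ball x (Λ * r), g z ∂μ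

/-! ### Functions of bounded variation -/

/-- The pointwise Lipschitz constant
`Lip h (x) = liminf_{r → 0} sup_{d(x, x') < r} ‖h x - h x'‖ / r`. -/
def pointLip {X V : Type*} [PseudoMetricSpace X] [PseudoEMetricSpace V]
    (h : X → V) (x : X) : ℝ≥0∞ :=
  liminf (fun r : ℝ => (⨆ x' ∈ ball x r, edist (h x) (h x')) / ENNReal.ofReal r) (𝓝[>] 0)

/-- The variation `VAR(h, W)` of `h` in the open set `W`: the infimum of
`liminf ∫_W Lip h_i dμ` over all sequences of locally Lipschitz functions `h_i` on `W` converging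
to `h` in `L¹(W)`. Only the values of `h` and `h_i` on `W` matter. -/
def variation {X V : Type*} [MetricSpace X] [MeasurableSpace X] [NormedAddCommGroup V]
    (μ : Measure X) (h : X → V) (W : Set X) : ℝ≥0∞ :=
  ⨅ (hs : ℕ → X → V) (_ : ∀ i, LocallyLipschitzOn W (hs i))
    (_ : Tendsto (fun i => eLpNorm (hs i - h) 1 (μ.restrict W)) atTop (𝓝 0)),
    liminf (fun i => ∫⁻ x in W, pointLip (hs i) x ∂μ) atTop

/-- `h ∈ BV(U, V)`: `h ∈ L¹(U, V)` (in the sense of Bochner) and `h` has finite variation. -/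
def IsBV {X V : Type*} [MetricSpace X] [MeasurableSpace X] [NormedAddCommGroup V]
    (μ : Measure X) (U : Set X) (h : X → V) : Prop :=
  MemLp h 1 (μ.restrict U) ∧ variation μ h U < ∞

/-! ### Cuts, and the cut measure of an `L¹` map into `L¹` -/

/-- `L¹` spaces carry their Borel σ-algebra. -/
instance instMeasurableSpaceLp {α E : Type*} [MeasurableSpace α] [NormedAddCommGroup E]
    {p : ℝ≥0∞} [Fact (1 ≤ p)] {μ : Measure α} : MeasurableSpace (Lp E p μ) := borel _

instance instBorelSpaceLp {α E : Type*} [MeasurableSpace α] [NormedAddCommGroup E]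
    {p : ℝ≥0∞} [Fact (1 ≤ p)] {μ : Measure α} : BorelSpace (Lp E p μ) := ⟨rfl⟩

/-- The cuts of a measure space: the elements of `L¹` represented by characteristic functions of
(measurable) sets of finite measure, with the metric and the Borel structure of `L¹`. -/
def Cut {α : Type*} [MeasurableSpace α] (μ : Measure α) : Type _ :=
  {v : Lp ℝ 1 μ // ∃ (s : Set α) (hs : MeasurableSet s) (hμs : μ s ≠ ∞),
    v = indicatorConstLp 1 hs hμs (1 : ℝ)}

instance instMeasurableSpaceCut {α : Type*} [MeasurableSpace α] {μ : Measure α} :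
    MeasurableSpace (Cut μ) :=
  Subtype.instMeasurableSpace

/-- The set `{u ≥ t}` for `t > 0`, `∅` for `t = 0`, and `{u ≤ t}` for `t < 0`. -/
def sliceSet {α : Type*} (u : α → ℝ) (t : ℝ) : Set α :=
  {x | (0 < t ∧ t ≤ u x) ∨ (t < 0 ∧ u x ≤ t)}

theorem measurableSet_sliceSet {α : Type*} [MeasurableSpace α] {u : α → ℝ} (hu : Measurable u)
    (t : ℝ) : MeasurableSet (sliceSet u t) :=
  ((MeasurableSet.const _).inter (measurableSet_le measurable_const hu)).union
    ((MeasurableSet.const _).inter (measurableSet_le hu measurable_const))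

theorem measure_sliceSet_ne_top {α : Type*} [MeasurableSpace α] {μ : Measure α} {u : α → ℝ}
    (hu : MemLp u 1 μ) (t : ℝ) : μ (sliceSet u t) ≠ ∞ := by
  rcases eq_or_ne t 0 with rfl | ht
  · simp [sliceSet]
  · have h : 0 < ‖t‖₊ := nnnorm_pos.2 ht
    refine ne_top_of_le_ne_top
      (hu.meas_ge_lt_top one_ne_zero ENNReal.one_ne_top h.ne').ne (measure_mono ?_)
    rintro x (⟨h0, hx⟩ | ⟨h0, hx⟩)
    · change ‖t‖ ≤ ‖u x‖
      rw [Real.norm_of_nonneg h0.le, Real.norm_of_nonneg (h0.le.trans hx)]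
      exact hx
    · change ‖t‖ ≤ ‖u x‖
      rw [Real.norm_of_nonpos h0.le, Real.norm_of_nonpos (hx.trans h0.le)]
      linarith

/-- The map `Slice : L¹ × ℝ → Cut`. -/
def slice {α : Type*} [MeasurableSpace α] {μ : Measure α} (q : Lp ℝ 1 μ × ℝ) : Cut μ :=
  ⟨indicatorConstLp 1 (measurableSet_sliceSet (Lp.stronglyMeasurable q.1).measurable q.2)
    (measure_sliceSet_ne_top (Lp.memLp q.1) q.2) 1, _, _, _, rfl⟩

open Classical in
/-- The element `H ∈ L¹(X × Y)` corresponding to `f ∈ L¹(X, L¹(Y))`, i.e. `H(x, ·) = f(x)` in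
`L¹(Y)` for almost every `x`. It exists by Fubini's theorem whenever `f ∈ L¹(X, L¹(Y))`, and is
unique up to null sets; the value `0` is used only for other `f`. -/
def jointFunction {α Y : Type*} [MeasurableSpace α] [MeasurableSpace Y] (μ : Measure α)
    (ν : Measure Y) (f : α → Lp ℝ 1 ν) : α × Y → ℝ :=
  if h : ∃ H : α × Y → ℝ, Integrable H (μ.prod ν) ∧
      ∀ᵐ x ∂μ, (fun y => H (x, y)) =ᵐ[ν] f x
  then h.choose else 0

open Classical in
/-- The map `g : Y → L¹(X)` induced by `f ∈ L¹(X, L¹(Y))`: `g(y) = H(·, y)` when this function is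
in `L¹(X)`, which is the case for almost every `y`, and `g(y) = 0` otherwise. -/
def transpose {α Y : Type*} [MeasurableSpace α] [MeasurableSpace Y] (μ : Measure α)
    (ν : Measure Y) (f : α → Lp ℝ 1 ν) (y : Y) : Lp ℝ 1 μ :=
  if h : MemLp (fun x => jointFunction μ ν f (x, y)) 1 μ then h.toLp else 0

/-- The Borel measure `𝒯_f = g_* ν` on `L¹(X)`. -/
def tautMeasure {α Y : Type*} [MeasurableSpace α] [MeasurableSpace Y] (μ : Measure α)
    (ν : Measure Y) (f : α → Lp ℝ 1 ν) : Measure (Lp ℝ 1 μ) :=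
  ν.map (transpose μ ν f)

/-- The cut measure `Σ_f = Slice_* (𝒯_f × Lebesgue)` of an `L¹` map `f : X → L¹(Y)`. -/
def cutMeasure {α Y : Type*} [MeasurableSpace α] [MeasurableSpace Y] (μ : Measure α)
    (ν : Measure Y) (f : α → Lp ℝ 1 ν) : Measure (Cut μ) :=
  ((tautMeasure μ ν f).prod volume).map slice

/-! ### The total perimeter measure -/

/-- The perimeter measure `Per(E, U)` of a cut `E` of the open set `U`, evaluated at `A ⊆ U`:
it is `VAR(χ_E, A)` for `A` open, and is extended to all sets by outer regularity. -/
def perimeterMeasure {X : Type*} [MetricSpace X] [MeasurableSpace X] (μ : Measure X) (U : Set X)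
    (E : Cut (μ.restrict U)) (A : Set X) : ℝ≥0∞ :=
  ⨅ (W : Set X) (_ : IsOpen W) (_ : A ⊆ W) (_ : W ⊆ U), variation μ E.1 W

/-- The total perimeter measure of a cut measure `S` on `Cut(U)`, evaluated at `A ⊆ U`:
`λ_S(A) = ∫ Per(E, U)(A) dS(E)`. -/
def totalPerimeter {X : Type*} [MetricSpace X] [MeasurableSpace X] (μ : Measure X) (U : Set X)
    (S : Measure (Cut (μ.restrict U))) (A : Set X) : ℝ≥0∞ :=
  ∫⁻ E, perimeterMeasure μ U E A ∂S

end TotalPerimeter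

end

/-
From a perimeter bound to a Lipschitz map: the Poincaré inequality bounds the oscillation of a
cut on a ball by its perimeter on a larger ball. Oscillation is additive over the slices of a
function (Cavalieri), so integrating over the cut measure bounds the `L¹(Y)`-valued mean oscillation
of `f` on a ball of radius `r` by a multiple of `L * r`. Summing over a chain of dyadic balls
shrinking to a point shows that the averages converge to a Lipschitz representative, and subdividing
a curve propagates the local estimate along it.

From a Lipschitz map to a perimeter bound on an open set `A`: average each function `g y = f(·)(y)`
against tent functions at a Lipschitz scale `δ z` so small that `f` is `L`-Lipschitz near `z` at
that scale. These averages are locally Lipschitz on `A`, and the integral over `Y` of their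
pointwise Lipschitz constants at `z` is at most a multiple of `L`. Letting the scale tend to `0`,
the coarea inequality bounds the perimeter in `A` integrated over all slices by the limit inferior
of the integrals of these Lipschitz constants.
-/

namespace TotalPerimeter

section PointLip

variable {X V : Type*} [PseudoMetricSpace X] [PseudoEMetricSpace V]

theorem pointLip_le {h : X → V} {x : X} {K : ℝ≥0∞}
    (hK : ∀ᶠ x' in 𝓝 x, edist (h x) (h x') ≤ K * edist x x') : pointLip h x ≤ K := by
  obtain ⟨ε, hε, hball⟩ := Metric.eventually_nhds_iff_ball.1 hK
  refine liminf_le_of_frequently_le' (Eventually.frequently ?_)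
  filter_upwards [Ioo_mem_nhdsGT hε] with r hr
  refine ENNReal.div_le_of_le_mul (iSup₂_le fun x' hx' => ?_)
  calc edist (h x) (h x') ≤ K * edist x x' := hball x' (ball_subset_ball hr.2.le hx')
    _ ≤ K * ENNReal.ofReal r := by
        gcongr
        rw [edist_comm, edist_dist]
        exact ENNReal.ofReal_le_ofReal (mem_ball.1 hx').le

theorem iInf_rat_div_ofReal_le {φ : ℝ → ℝ≥0∞} (hφ : Monotone φ) {r ε : ℝ} (hr : 0 < r)
    (hrε : r < ε) :
    ⨅ q : ℚ, ⨅ (_ : 0 < q ∧ (q : ℝ) < ε), φ q / ENNReal.ofReal q ≤ φ r / ENNReal.ofReal r := by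
  set a := ⨅ q : ℚ, ⨅ (_ : 0 < q ∧ (q : ℝ) < ε), φ q / ENNReal.ofReal q
  obtain ⟨q, -, hqr, hqlim⟩ := Real.exists_seq_rat_strictMono_tendsto r
  have hr' : ENNReal.ofReal r ≠ 0 := by simpa using hr
  have hlim : Tendsto (fun k => a * ENNReal.ofReal (q k)) atTop (𝓝 (a * ENNReal.ofReal r)) :=
    ENNReal.Tendsto.const_mul (ENNReal.tendsto_ofReal hqlim) (Or.inl hr')
  rw [ENNReal.le_div_iff_mul_le (Or.inl hr') (Or.inl ENNReal.ofReal_ne_top)]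
  refine le_of_tendsto hlim ?_
  filter_upwards [hqlim.eventually_const_lt hr] with k hk
  rw [← ENNReal.le_div_iff_mul_le (Or.inl (by simpa using hk)) (Or.inl ENNReal.ofReal_ne_top)]
  calc a ≤ φ (q k) / ENNReal.ofReal (q k) :=
        iInf₂_le (q k) ⟨by exact_mod_cast hk, (hqr k).trans hrε⟩
    _ ≤ φ r / ENNReal.ofReal (q k) := ENNReal.div_le_div_right (hφ (hqr k).le) _

theorem liminf_div_ofReal_eq_iSup_iInf_rat {φ : ℝ → ℝ≥0∞} (hφ : Monotone φ) :
    liminf (fun r => φ r / ENNReal.ofReal r) (𝓝[>] 0) =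
      ⨆ n : ℕ, ⨅ q : ℚ, ⨅ (_ : 0 < q ∧ (q : ℝ) < 1 / (n + 1)), φ q / ENNReal.ofReal q := by
  rw [(nhdsGT_basis (0 : ℝ)).liminf_eq_iSup_iInf]
  apply le_antisymm
  · refine iSup₂_le fun ε hε => ?_
    obtain ⟨n, hn⟩ := exists_nat_one_div_lt hε
    exact le_iSup_of_le n (le_iInf₂ fun q hq =>
      iInf₂_le (q : ℝ) ⟨by exact_mod_cast hq.1, hq.2.trans hn⟩)
  · exact iSup_le fun n => le_iSup₂_of_le (1 / ((n : ℝ) + 1)) Nat.one_div_pos_of_nat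
      (le_iInf₂ fun r hr => iInf_rat_div_ofReal_le hφ hr.1 hr.2)

theorem pointLip_eq_liminf_inter {W : Set X} (hW : IsOpen W) (h : X → V) {x : X} (hx : x ∈ W) :
    pointLip h x = liminf
      (fun r : ℝ => (⨆ x' ∈ ball x r ∩ W, edist (h x) (h x')) / ENNReal.ofReal r) (𝓝[>] 0) := by
  obtain ⟨ε, hε, hball⟩ := Metric.isOpen_iff.1 hW x hx
  refine liminf_congr ?_
  filter_upwards [Ioo_mem_nhdsGT hε] with r hr
  rw [inter_eq_left.2 ((ball_subset_ball hr.2.le).trans hball)]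

theorem lowerSemicontinuous_indicator_iSup_edist {W : Set X} (hW : IsOpen W) {h : X → V}
    (hh : ContinuousOn h W) (r : ℝ) :
    LowerSemicontinuous (W.indicator fun x => ⨆ x' ∈ ball x r ∩ W, edist (h x) (h x')) := by
  intro x a hxa
  by_cases hxW : x ∈ W
  · simp only [indicator_of_mem hxW, lt_iSup_iff] at hxa
    obtain ⟨x', ⟨hx'r, hx'W⟩, hax'⟩ := hxa
    have hcont : ContinuousAt (fun z => edist (h z) (h x')) x :=
      (hh.continuousAt (hW.mem_nhds hxW)).edist continuousAt_const
    filter_upwards [hW.mem_nhds hxW, hcont.eventually_const_lt hax',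
      isOpen_ball.mem_nhds (mem_ball_comm.1 hx'r)] with z hzW hza hzx'
    rw [indicator_of_mem hzW]
    exact hza.trans_le (le_iSup₂_of_le x' ⟨mem_ball_comm.1 hzx', hx'W⟩ le_rfl)
  · rw [indicator_of_notMem hxW] at hxa
    exact absurd hxa not_lt_zero

theorem measurable_indicator_pointLip [MeasurableSpace X] [BorelSpace X] {W : Set X}
    (hW : IsOpen W) {h : X → V} (hh : ContinuousOn h W) :
    Measurable (W.indicator (pointLip h)) := by
  have hmeas : Measurable fun x => ⨆ n : ℕ, ⨅ q : ℚ, ⨅ (_ : 0 < q ∧ (q : ℝ) < 1 / ((n : ℝ) + 1)),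
      (W.indicator (fun x => ⨆ x' ∈ ball x (q : ℝ) ∩ W, edist (h x) (h x')) x)
        / ENNReal.ofReal q :=
    Measurable.iSup fun n => Measurable.iInf fun q => Measurable.iInf fun _ =>
      (lowerSemicontinuous_indicator_iSup_edist hW hh q).measurable.div_const _
  convert hmeas.indicator hW.measurableSet using 1
  refine indicator_congr fun x hx => ?_
  have hmono : Monotone fun r : ℝ => ⨆ x' ∈ ball x r ∩ W, edist (h x) (h x') := fun r r' hr =>
    biSup_mono fun x' hx' => ⟨ball_subset_ball hr hx'.1, hx'.2⟩
  rw [pointLip_eq_liminf_inter hW h hx, liminf_div_ofReal_eq_iSup_iInf_rat hmono]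
  simp only [indicator_of_mem hx]

theorem edist_le_iSup_ball_of_lipschitzOnWith_one {h : X → V} {c : ℝ → X} {s r : ℝ} (hr : 0 < r)
    (hc : LipschitzOnWith 1 c (Icc s (s + r)))
    (hhc : ContinuousWithinAt (h ∘ c) (Iio (s + r)) (s + r)) :
    edist (h (c s)) (h (c (s + r))) ≤ ⨆ x' ∈ ball (c s) r, edist (h (c s)) (h x') := by
  refine le_of_tendsto (tendsto_const_nhds.edist hhc.tendsto) ?_
  filter_upwards [Ioo_mem_nhdsLT (show s < s + r by linarith)] with u hu
  refine le_iSup₂_of_le (f := fun x' _ => edist (h (c s)) (h x')) (c u) ?_ le_rfl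
  calc dist (c u) (c s) ≤ (1 : ℝ≥0) * dist u s :=
        hc.dist_le_mul u ⟨hu.1.le, hu.2.le⟩ s ⟨le_rfl, by linarith⟩
    _ = u - s := by rw [NNReal.coe_one, one_mul, Real.dist_eq, abs_of_pos (sub_pos.2 hu.1)]
    _ < r := by linarith [hu.2]

theorem enorm_deriv_comp_le_pointLip {h : X → ℝ} {c : ℝ → X} {a b s : ℝ}
    (hs : s ∈ Ioo a b) (hc : LipschitzOnWith 1 c (Icc a b)) (hhc : ContinuousOn (h ∘ c) (Icc a b))
    (hd : DifferentiableAt ℝ (h ∘ c) s) : ‖deriv (h ∘ c) s‖ₑ ≤ pointLip h (c s) := by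
  rw [← hd.hasDerivAt.tendsto_slope_zero_right.enorm.liminf_eq]
  refine liminf_le_liminf ?_
  filter_upwards [Ioo_mem_nhdsGT (sub_pos.2 hs.2)] with r ⟨hr0, hr⟩
  have hsr : s + r ∈ Ioo a b := ⟨by linarith [hs.1], by linarith⟩
  have hslope : ‖r⁻¹ • ((h ∘ c) (s + r) - (h ∘ c) s)‖ₑ
      = edist (h (c s)) (h (c (s + r))) / ENNReal.ofReal r := by
    rw [enorm_smul, enorm_inv hr0.ne', Real.enorm_eq_ofReal hr0.le, ← edist_eq_enorm_sub,
      edist_comm, mul_comm]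
    rfl
  rw [hslope]
  exact ENNReal.div_le_div_right (edist_le_iSup_ball_of_lipschitzOnWith_one hr0
    (hc.mono (Icc_subset_Icc hs.1.le hsr.2.le))
    (hhc.continuousAt (Icc_mem_nhds hsr.1 hsr.2)).continuousWithinAt) _

theorem lipschitzOnWith_one_of_hasUnitSpeedOn {c : ℝ → X} {s : Set ℝ} (hc : HasUnitSpeedOn c s) :
    LipschitzOnWith 1 c s := by
  have hle : ∀ u ∈ s, ∀ v ∈ s, u ≤ v → edist (c u) (c v) ≤ edist u v := fun u hu v hv huv =>
    calc edist (c u) (c v) ≤ eVariationOn c (s ∩ Icc u v) :=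
          eVariationOn.edist_le c ⟨hu, le_rfl, huv⟩ ⟨hv, huv, le_rfl⟩
      _ = edist u v := by
          rw [hc hu hv, edist_comm, edist_dist, Real.dist_eq, abs_of_nonneg (sub_nonneg.2 huv),
            NNReal.coe_one, one_mul]
  intro u hu v hv
  rw [ENNReal.coe_one, one_mul]
  rcases le_total u v with huv | hvu
  · exact hle u hu v hv huv
  · rw [edist_comm, edist_comm u v]
    exact hle v hv u hu hvu

theorem exists_lipschitzOnWith_comp {E : Type*} [PseudoMetricSpace E] {W : Set X} {h : X → E}
    (hh : LocallyLipschitzOn W h) {a b : ℝ} {c : ℝ → X} {M : ℝ≥0}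
    (hc : LipschitzOnWith M c (Icc a b)) (hcW : MapsTo c (Icc a b) W) :
    ∃ K, LipschitzOnWith K (h ∘ c) (Icc a b) := by
  suffices hloc : LocallyLipschitzOn (Icc a b) (h ∘ c) from
    hloc.exists_lipschitzOnWith_of_compact isCompact_Icc
  intro s hs
  obtain ⟨K, t, ht, hK⟩ := hh (hcW hs)
  have hmem : c ⁻¹' t ∈ 𝓝[Icc a b] s := (hc.continuousOn s hs).tendsto_nhdsWithin hcW ht
  exact ⟨K * M, c ⁻¹' t ∩ Icc a b, inter_mem hmem self_mem_nhdsWithin,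
    hK.comp (hc.mono inter_subset_right) fun _ hx => hx.1⟩

theorem edist_le_lintegral_pointLip {W : Set X} {h : X → ℝ}
    (hh : LocallyLipschitzOn W h) {ℓ : ℝ} (hℓ : 0 ≤ ℓ) {c : ℝ → X}
    (hc : HasUnitSpeedOn c (Icc 0 ℓ)) (hcW : MapsTo c (Icc 0 ℓ) W) :
    edist (h (c ℓ)) (h (c 0)) ≤ ∫⁻ s in Icc 0 ℓ, pointLip h (c s) := by
  have hc1 := lipschitzOnWith_one_of_hasUnitSpeedOn hc
  obtain ⟨K, hK⟩ := exists_lipschitzOnWith_comp hh hc1 hcW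
  have hac : AbsolutelyContinuousOnInterval (h ∘ c) 0 ℓ :=
    LipschitzOnWith.absolutelyContinuousOnInterval (by rwa [uIcc_of_le hℓ])
  calc edist (h (c ℓ)) (h (c 0)) = ‖∫ s in Ioo 0 ℓ, deriv (h ∘ c) s‖ₑ := by
        rw [restrict_Ioo_eq_restrict_Ioc, ← intervalIntegral.integral_of_le hℓ,
          hac.integral_deriv_eq_sub, edist_eq_enorm_sub]
        rfl
    _ ≤ ∫⁻ s in Ioo 0 ℓ, ‖deriv (h ∘ c) s‖ₑ := enorm_integral_le_lintegral_enorm _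
    _ ≤ ∫⁻ s in Ioo 0 ℓ, pointLip h (c s) := by
        refine setLIntegral_mono_ae' measurableSet_Ioo ?_
        filter_upwards [hac.ae_differentiableAt] with s hs hsℓ
        exact enorm_deriv_comp_le_pointLip hsℓ hc1 hK.continuousOn
          (hs (uIcc_of_le hℓ ▸ Ioo_subset_Icc_self hsℓ))
    _ ≤ ∫⁻ s in Icc 0 ℓ, pointLip h (c s) := lintegral_mono_set Ioo_subset_Icc_self

end PointLip

section Variation

variable {X V : Type*} [MetricSpace X] [MeasurableSpace X] [NormedAddCommGroup V] {μ : Measure X}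

theorem variation_le {h : X → V} {W : Set X} {hs : ℕ → X → V}
    (hL : ∀ i, LocallyLipschitzOn W (hs i))
    (ht : Tendsto (fun i => eLpNorm (hs i - h) 1 (μ.restrict W)) atTop (𝓝 0)) :
    variation μ h W ≤ liminf (fun i => ∫⁻ x in W, pointLip (hs i) x ∂μ) atTop :=
  iInf_le_of_le hs (iInf_le_of_le hL (iInf_le _ ht))

theorem le_variation {h : X → V} {W : Set X} {b : ℝ≥0∞}
    (hb : ∀ hs : ℕ → X → V, (∀ i, LocallyLipschitzOn W (hs i)) →
      Tendsto (fun i => eLpNorm (hs i - h) 1 (μ.restrict W)) atTop (𝓝 0) →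
      b ≤ liminf (fun i => ∫⁻ x in W, pointLip (hs i) x ∂μ) atTop) :
    b ≤ variation μ h W :=
  le_iInf fun hs => le_iInf fun hL => le_iInf fun ht => hb hs hL ht

theorem variation_mono_set (h : X → V) {W W' : Set X} (hW : W ⊆ W') :
    variation μ h W ≤ variation μ h W' :=
  le_variation fun _ hL ht => (variation_le (fun i => (hL i).mono hW)
    (tendsto_of_tendsto_of_tendsto_of_le_of_le tendsto_const_nhds ht (fun _ => zero_le)
      fun _ => eLpNorm_mono_measure _ (Measure.restrict_mono hW le_rfl))).trans
    (liminf_le_liminf (Eventually.of_forall fun _ => lintegral_mono_set hW))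

theorem variation_congr_ae {h h' : X → V} {W : Set X} (hh : h =ᵐ[μ.restrict W] h') :
    variation μ h W = variation μ h' W := by
  have hnorm : ∀ v : X → V, eLpNorm (v - h) 1 (μ.restrict W) = eLpNorm (v - h') 1 (μ.restrict W) :=
    fun v => eLpNorm_congr_ae (EventuallyEq.rfl.sub hh)
  simp only [variation, hnorm]

theorem perimeterMeasure_of_isOpen {U A : Set X} (hA : IsOpen A) (hAU : A ⊆ U)
    (E : Cut (μ.restrict U)) : perimeterMeasure μ U E A = variation μ E.1 A :=
  le_antisymm (iInf_le_of_le A (iInf_le_of_le hA (iInf_le_of_le le_rfl (iInf_le _ hAU))))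
    (le_iInf fun _ => le_iInf fun _ => le_iInf fun hW => le_iInf fun _ => variation_mono_set _ hW)

end Variation

section DoubleOsc

variable {α V : Type*} [MeasurableSpace α] [NormedAddCommGroup V] {μ : Measure α} {B : Set α}

/-- The double oscillation `∫_B ∫_B ‖u z - u w‖ dμ dμ`: the mean oscillation of `u` over `B` up to
the factor `(μ B)²`. Unlike the deviation from the average, it is additive over the slices of
`u`. -/
noncomputable def doubleOsc (μ : Measure α) (B : Set α) (u : α → V) : ℝ≥0∞ :=
  ∫⁻ z in B, ∫⁻ w in B, ‖u z - u w‖ₑ ∂μ ∂μ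

theorem doubleOsc_congr {u v : α → V} (h : u =ᵐ[μ.restrict B] v) :
    doubleOsc μ B u = doubleOsc μ B v := by
  refine lintegral_congr_ae ?_
  filter_upwards [h] with z hz
  refine lintegral_congr_ae ?_
  filter_upwards [h] with w hw
  rw [hz, hw]

theorem doubleOsc_le_add {u v : α → V} (huv : AEStronglyMeasurable (u - v) (μ.restrict B)) :
    doubleOsc μ B u ≤ doubleOsc μ B v + 2 * μ B * ∫⁻ z in B, ‖u z - v z‖ₑ ∂μ := by
  have hm : AEMeasurable (fun z => ‖u z - v z‖ₑ) (μ.restrict B) := huv.enorm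
  calc doubleOsc μ B u
      ≤ ∫⁻ z in B, ∫⁻ w in B, (‖v z - v w‖ₑ + (‖u z - v z‖ₑ + ‖u w - v w‖ₑ)) ∂μ ∂μ := by
        refine lintegral_mono fun z => lintegral_mono fun w => ?_
        rw [show u z - u w = (v z - v w) + ((u z - v z) - (u w - v w)) by abel]
        exact (enorm_add_le _ _).trans (add_le_add le_rfl enorm_sub_le)
    _ = ∫⁻ z in B, (∫⁻ w in B, ‖v z - v w‖ₑ ∂μ
          + (‖u z - v z‖ₑ * μ B + ∫⁻ w in B, ‖u w - v w‖ₑ ∂μ)) ∂μ := by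
        refine lintegral_congr fun z => ?_
        have hz : AEMeasurable (fun w => ‖u z - v z‖ₑ + ‖u w - v w‖ₑ) (μ.restrict B) :=
          aemeasurable_const.add hm
        rw [lintegral_add_right' _ hz, lintegral_add_left measurable_const, setLIntegral_const]
    _ = doubleOsc μ B v + 2 * μ B * ∫⁻ z in B, ‖u z - v z‖ₑ ∂μ := by
        have hz : AEMeasurable (fun z => ‖u z - v z‖ₑ * μ B + ∫⁻ w in B, ‖u w - v w‖ₑ ∂μ)
            (μ.restrict B) := (hm.mul_const _).add aemeasurable_const
        rw [lintegral_add_right' _ hz, lintegral_add_right _ measurable_const,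
          lintegral_mul_const'' _ hm, setLIntegral_const, doubleOsc]
        ring

theorem doubleOsc_le_lintegral_enorm_sub_const {u : α → V}
    (hu : AEStronglyMeasurable u (μ.restrict B)) (c : V) :
    doubleOsc μ B u ≤ 2 * μ B * ∫⁻ z in B, ‖u z - c‖ₑ ∂μ := by
  simpa [doubleOsc] using doubleOsc_le_add (v := fun _ => c) (hu.sub aestronglyMeasurable_const)

end DoubleOsc

section Poincare

theorem lintegral_indicator_compl_top_eq_top {X : Type*} [TopologicalSpace X] {c : ℝ → X} {a b : ℝ}
    (hab : a < b) (hc : ContinuousOn c (Icc a b)) {K : Set X} (hK : IsClosed K)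
    (hcK : ¬ MapsTo c (Icc a b) K) : ∫⁻ s in Icc a b, Kᶜ.indicator ⊤ (c s) = ∞ := by
  have hO : IsOpen (Ioo a b ∩ c ⁻¹' Kᶜ) :=
    (hc.mono Ioo_subset_Icc_self).isOpen_inter_preimage isOpen_Ioo hK.isOpen_compl
  have hne : (Ioo a b ∩ c ⁻¹' Kᶜ).Nonempty := by
    by_contra hempty
    have hIoo : MapsTo c (Ioo a b) K := fun s hs => by
      by_contra hsK
      exact hempty ⟨s, hs, hsK⟩
    rw [← closure_Ioo hab.ne] at hc hcK
    exact hcK (hK.closure_eq ▸ hIoo.closure_of_continuousOn hc)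
  refine eq_top_iff.2 ?_
  calc (∞ : ℝ≥0∞) = ∫⁻ _ in Ioo a b ∩ c ⁻¹' Kᶜ, ∞ := by
        rw [setLIntegral_const, ENNReal.top_mul (hO.measure_pos _ hne).ne']
    _ ≤ ∫⁻ s in Ioo a b ∩ c ⁻¹' Kᶜ, Kᶜ.indicator ⊤ (c s) :=
        setLIntegral_mono' hO.measurableSet fun s hs => by
          rw [indicator_of_mem (show c s ∈ Kᶜ from hs.2), Pi.top_apply]
    _ ≤ ∫⁻ s in Icc a b, Kᶜ.indicator ⊤ (c s) :=
        lintegral_mono_set (inter_subset_left.trans Ioo_subset_Icc_self)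

variable {X : Type*} [MetricSpace X] [MeasurableSpace X] [BorelSpace X]
  {μ : Measure X} {R : ℝ≥0∞} {β Λ τ : ℝ≥0}

-- The infinite weight outside `K` makes the inequality trivial along the curves that leave `W`.
theorem isUpperGradient_of_locallyLipschitzOn {W : Set X} (hW : IsOpen W) {v : X → ℝ}
    (hv : LocallyLipschitzOn W v) {K : Set X} (hK : IsClosed K) (hKW : K ⊆ W) :
    IsUpperGradient (fun z => Kᶜ.indicator ⊤ z + W.indicator (pointLip v) z)
      (W.indicator v) := by
  refine ⟨(measurable_const.indicator hK.measurableSet.compl).add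
    (measurable_indicator_pointLip hW hv.continuousOn), fun ℓ c hℓ hc => ?_⟩
  by_cases hcK : MapsTo c (Icc 0 ℓ) K
  · have hcW : MapsTo c (Icc 0 ℓ) W := fun s hs => hKW (hcK hs)
    rw [indicator_of_mem (hcW ⟨hℓ, le_rfl⟩), indicator_of_mem (hcW ⟨le_rfl, hℓ⟩)]
    refine (edist_le_lintegral_pointLip hv hℓ hc hcW).trans ?_
    refine setLIntegral_mono' measurableSet_Icc fun s hs => ?_
    simp only [indicator_of_mem (hcW hs)]
    exact le_add_self
  · rcases hℓ.eq_or_lt with rfl | hℓ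
    · simp
    have htop := lintegral_indicator_compl_top_eq_top hℓ
      (lipschitzOnWith_one_of_hasUnitSpeedOn hc).continuousOn hK hcK
    calc edist (W.indicator v (c ℓ)) (W.indicator v (c 0))
        ≤ ∫⁻ s in Icc 0 ℓ, Kᶜ.indicator ⊤ (c s) := htop ▸ le_top
      _ ≤ _ := lintegral_mono fun s => le_self_add

theorem IsPIMeasure.lintegral_enorm_sub_setAverage_le (h : IsPIMeasure μ R β Λ τ)
    {x : X} {s : ℝ} (hs : 0 < s) (hsR : ENNReal.ofReal s ≤ R) {W : Set X} (hW : IsOpen W)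
    (hsW : ball x s ⊆ W) (hΛW : closedBall x (Λ * s) ⊆ W) {v : X → ℝ}
    (hv : LocallyLipschitzOn W v) (hvi : IntegrableOn v W μ) :
    ∫⁻ z in ball x s, ‖v z - ⨍ w in ball x s, v w ∂μ‖ₑ ∂μ
      ≤ ENNReal.ofReal s * τ * ∫⁻ z in W, pointLip v z ∂μ := by
  have havg : ⨍ w in ball x s, W.indicator v w ∂μ = ⨍ w in ball x s, v w ∂μ := by
    rw [setAverage_eq, setAverage_eq, setIntegral_congr_fun measurableSet_ball fun z hz =>
      indicator_of_mem (hsW hz) v]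
  calc ∫⁻ z in ball x s, ‖v z - ⨍ w in ball x s, v w ∂μ‖ₑ ∂μ
      = ∫⁻ z in ball x s, ‖W.indicator v z - ⨍ w in ball x s, W.indicator v w ∂μ‖ₑ ∂μ := by
        refine setLIntegral_congr_fun measurableSet_ball fun z hz => ?_
        simp only [indicator_of_mem (hsW hz), havg]
    _ ≤ ENNReal.ofReal s * τ * ∫⁻ z in ball x (Λ * s),
          ((closedBall x (Λ * s))ᶜ.indicator ⊤ z + W.indicator (pointLip v) z) ∂μ :=
        h.poincare _ _
          (fun _ _ => ((integrable_indicator_iff hW.measurableSet).2 hvi).integrableOn)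
          (isUpperGradient_of_locallyLipschitzOn hW hv isClosed_closedBall hΛW) x s hs hsR
    _ = ENNReal.ofReal s * τ * ∫⁻ z in ball x (Λ * s), pointLip v z ∂μ := by
        congr 1
        refine setLIntegral_congr_fun measurableSet_ball fun z hz => ?_
        have hz' := ball_subset_closedBall hz
        simp only [indicator_of_mem (hΛW hz'), indicator_of_notMem (notMem_compl_iff.2 hz'),
          zero_add]
    _ ≤ ENNReal.ofReal s * τ * ∫⁻ z in W, pointLip v z ∂μ := by
        gcongr
        exact ball_subset_closedBall.trans hΛW

theorem IsPIMeasure.doubleOsc_le_of_locallyLipschitzOn (h : IsPIMeasure μ R β Λ τ)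
    {x : X} {s : ℝ} (hs : 0 < s) (hsR : ENNReal.ofReal s ≤ R) {W : Set X} (hW : IsOpen W)
    (hsW : ball x s ⊆ W) (hΛW : closedBall x (Λ * s) ⊆ W) {v : X → ℝ}
    (hv : LocallyLipschitzOn W v) (hvi : IntegrableOn v W μ) :
    doubleOsc μ (ball x s) v
      ≤ 2 * μ (ball x s) * (ENNReal.ofReal s * τ) * ∫⁻ z in W, pointLip v z ∂μ :=
  calc doubleOsc μ (ball x s) v
      ≤ 2 * μ (ball x s) * ∫⁻ z in ball x s, ‖v z - ⨍ w in ball x s, v w ∂μ‖ₑ ∂μ :=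
        doubleOsc_le_lintegral_enorm_sub_const (hvi.mono_set hsW).aestronglyMeasurable _
    _ ≤ 2 * μ (ball x s) * (ENNReal.ofReal s * τ * ∫⁻ z in W, pointLip v z ∂μ) := by
        gcongr
        exact h.lintegral_enorm_sub_setAverage_le hs hsR hW hsW hΛW hv hvi
    _ = _ := (mul_assoc _ _ _).symm

theorem IsPIMeasure.doubleOsc_le_add_eLpNorm_sub (h : IsPIMeasure μ R β Λ τ)
    {x : X} {s : ℝ} (hs : 0 < s) (hsR : ENNReal.ofReal s ≤ R) {W : Set X} (hW : IsOpen W)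
    (hsW : ball x s ⊆ W) (hΛW : closedBall x (Λ * s) ⊆ W) {u v : X → ℝ} (hu : IntegrableOn u W μ)
    (hv : LocallyLipschitzOn W v) (huv : eLpNorm (v - u) 1 (μ.restrict W) < ∞) :
    doubleOsc μ (ball x s) u
      ≤ 2 * μ (ball x s) * (ENNReal.ofReal s * τ) * ∫⁻ z in W, pointLip v z ∂μ
        + 2 * μ (ball x s) * eLpNorm (v - u) 1 (μ.restrict W) := by
  have hvm : AEStronglyMeasurable v (μ.restrict W) :=
    hv.continuousOn.aestronglyMeasurable hW.measurableSet
  have hvi : IntegrableOn v W μ := by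
    have hdiff : Integrable (v - u) (μ.restrict W) :=
      memLp_one_iff_integrable.1 ⟨hvm.sub hu.aestronglyMeasurable, huv⟩
    have hadd := hdiff.add hu
    rwa [sub_add_cancel] at hadd
  have hosc := doubleOsc_le_add (v := v)
    ((hu.aestronglyMeasurable.sub hvm).mono_measure (Measure.restrict_mono hsW le_rfl))
  refine hosc.trans (add_le_add ?_ ?_)
  · exact h.doubleOsc_le_of_locallyLipschitzOn hs hsR hW hsW hΛW hv hvi
  · rw [eLpNorm_sub_comm, eLpNorm_one_eq_lintegral_enorm]
    gcongr
    exact le_rfl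

-- The constant is `τ + 1` because for `τ = 0` and infinite variation a factor `τ` would give `0`.
theorem IsPIMeasure.doubleOsc_le_variation (h : IsPIMeasure μ R β Λ τ)
    {x : X} {s : ℝ} (hs : 0 < s) (hsR : ENNReal.ofReal s ≤ R) {W : Set X} (hW : IsOpen W)
    (hsW : ball x s ⊆ W) (hΛW : closedBall x (Λ * s) ⊆ W) {u : X → ℝ} (hu : IntegrableOn u W μ) :
    doubleOsc μ (ball x s) u
      ≤ 2 * μ (ball x s) * (ENNReal.ofReal s * (τ + 1)) * variation μ u W := by
  have hBtop : 2 * μ (ball x s) ≠ ∞ := ENNReal.mul_ne_top (by simp) (h.ball_lt_top x s).ne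
  set K := 2 * μ (ball x s) * (ENNReal.ofReal s * (τ + 1))
  have hKtop : K ≠ ∞ := ENNReal.mul_ne_top hBtop (ENNReal.mul_ne_top (by simp) (by simp))
  have hK0 : K ≠ 0 := mul_ne_zero (mul_ne_zero two_ne_zero (h.ball_pos x s hs).ne')
    (mul_ne_zero (by simpa using hs) (by simp))
  rw [mul_comm, ← ENNReal.div_le_iff hK0 hKtop]
  refine le_variation fun v hv hvu => ?_
  rw [ENNReal.div_le_iff hK0 hKtop, mul_comm]
  have hlim : Tendsto (fun i => 2 * μ (ball x s) * eLpNorm (v i - u) 1 (μ.restrict W)) atTop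
      (𝓝 0) := by
    simpa using ENNReal.Tendsto.const_mul hvu (Or.inr hBtop)
  rw [← ENNReal.liminf_const_mul_of_ne_top hKtop, ← ENNReal.liminf_add_of_right_tendsto_zero hlim]
  refine le_liminf_of_le (by isBoundedDefault) ?_
  filter_upwards [hvu.eventually_lt_const ENNReal.zero_lt_top] with i hi
  have hτ : 2 * μ (ball x s) * (ENNReal.ofReal s * τ) ≤ K :=
    mul_le_mul_right (mul_le_mul_right le_self_add _) _
  refine (h.doubleOsc_le_add_eLpNorm_sub hs hsR hW hsW hΛW hu (hv i) hi).trans ?_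
  exact add_le_add (mul_le_mul_left hτ _) le_rfl

end Poincare

theorem secondCountableTopology_of_isOpenPosMeasure {X : Type*} [PseudoMetricSpace X]
    [MeasurableSpace X] [OpensMeasurableSpace X] (μ : Measure X) [SFinite μ]
    [μ.IsOpenPosMeasure] : SecondCountableTopology X := by
  refine Metric.secondCountable_of_almost_dense_set fun ε hε => ?_
  obtain ⟨u, -, hdisj, hcover⟩ := Vitali.exists_disjoint_subfamily_covering_enlargement_closedBall
    (univ : Set X) id (fun _ => ε / 5) (ε / 5) (fun _ _ => le_rfl) 5 (by norm_num)
  refine ⟨u, ?_, fun x => ?_⟩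
  · have hcount := Measure.countable_meas_pos_of_disjoint_iUnion (μ := μ)
      (As := fun x : u => closedBall (x : X) (ε / 5)) (fun _ => measurableSet_closedBall)
      (fun a b hab => hdisj a.2 b.2 (fun hab' => hab (Subtype.ext hab')))
    have huniv : {i : u | 0 < μ (closedBall (i : X) (ε / 5))} = univ :=
      eq_univ_of_forall fun i => measure_closedBall_pos μ _ (by positivity)
    rw [huniv] at hcount
    exact countable_coe_iff.1 (countable_univ_iff.1 hcount)
  · obtain ⟨b, hb, hxb⟩ := hcover x (mem_univ x)
    refine ⟨b, hb, ?_⟩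
    simpa [mul_div_cancel₀] using hxb (mem_closedBall_self (by positivity))

namespace IsPIMeasure

variable {X : Type*} [MetricSpace X] [MeasurableSpace X] {μ : Measure X} {R : ℝ≥0∞}
  {β Λ τ : ℝ≥0}

theorem isLocallyFiniteMeasure (h : IsPIMeasure μ R β Λ τ) : IsLocallyFiniteMeasure μ :=
  ⟨fun x => ⟨ball x 1, ball_mem_nhds x one_pos, h.ball_lt_top x 1⟩⟩

theorem isOpenPosMeasure (h : IsPIMeasure μ R β Λ τ) : μ.IsOpenPosMeasure where
  open_pos := by
    rintro O hO ⟨x, hx⟩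
    obtain ⟨r, hr, hball⟩ := Metric.isOpen_iff.1 hO x hx
    exact ((h.ball_pos x r hr).trans_le (measure_mono hball)).ne'

theorem sigmaFinite (h : IsPIMeasure μ R β Λ τ) : SigmaFinite μ := by
  rcases isEmpty_or_nonempty X with hX | ⟨⟨x⟩⟩
  · rw [Measure.eq_zero_of_isEmpty μ]
    infer_instance
  · exact ⟨⟨{ set := fun n => ball x n
              set_mem := fun _ => trivial
              finite := fun n => h.ball_lt_top x n
              spanning := iUnion_ball_nat x }⟩⟩

theorem secondCountableTopology [BorelSpace X] (h : IsPIMeasure μ R β Λ τ) :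
    SecondCountableTopology X :=
  have := h.sigmaFinite
  have := h.isOpenPosMeasure
  secondCountableTopology_of_isOpenPosMeasure μ

theorem measure_ball_two_pow_mul_le (h : IsPIMeasure μ R β Λ τ) (x : X) (k : ℕ) {r : ℝ}
    (hr : 0 < r) (hR : ENNReal.ofReal (2 ^ k * r) ≤ R) :
    μ (ball x (2 ^ k * r)) ≤ (β : ℝ≥0∞) ^ k * μ (ball x r) := by
  induction k with
  | zero => simp
  | succ k ih =>
    have hle : ENNReal.ofReal (2 ^ k * r) ≤ R := by
      refine (ENNReal.ofReal_le_ofReal ?_).trans hR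
      gcongr <;> norm_num
    calc μ (ball x (2 ^ (k + 1) * r)) = μ (ball x (2 * (2 ^ k * r))) := by ring_nf
      _ ≤ β * μ (ball x (2 ^ k * r)) := h.doubling x _ (by positivity) hle
      _ ≤ β * (β ^ k * μ (ball x r)) := by gcongr; exact ih hle
      _ = β ^ (k + 1) * μ (ball x r) := by ring

theorem isUnifLocDoublingMeasure (h : IsPIMeasure μ R β Λ τ) (hR : 0 < R) :
    IsUnifLocDoublingMeasure μ := by
  obtain ⟨ρ, hρ0, hρR⟩ := ENNReal.lt_iff_exists_nnreal_btwn.1 hR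
  have hρ : (0 : ℝ) < ρ := by exact_mod_cast hρ0
  refine ⟨β ^ 2, ?_⟩
  filter_upwards [Ioo_mem_nhdsGT (show (0 : ℝ) < ρ / 4 by positivity)] with ε hε x
  have hεR : ENNReal.ofReal (2 ^ 2 * ε) ≤ R :=
    (ENNReal.ofReal_le_of_le_toReal (by simpa using by linarith [hε.2])).trans hρR.le
  calc μ (closedBall x (2 * ε)) ≤ μ (ball x (2 ^ 2 * ε)) :=
        measure_mono (closedBall_subset_ball (by linarith [hε.1]))
    _ ≤ (β : ℝ≥0∞) ^ 2 * μ (ball x ε) := h.measure_ball_two_pow_mul_le x 2 hε.1 hεR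
    _ ≤ ↑(β ^ 2) * μ (closedBall x ε) := by
        push_cast
        gcongr
        exact ball_subset_closedBall

end IsPIMeasure

theorem measurable_of_measurable_edist {α E : Type*} [MeasurableSpace α] [PseudoEMetricSpace E]
    [SecondCountableTopology E] [MeasurableSpace E] [BorelSpace E] {g : α → E}
    (hg : ∀ v, Measurable fun y => edist (g y) v) : Measurable g := by
  refine measurable_of_isOpen fun s hs => ?_
  choose r hr hrs using fun x : s => EMetric.isOpen_iff.1 hs x x.2
  obtain ⟨T, hT, hTs⟩ := TopologicalSpace.isOpen_iUnion_countable
    (fun x : s => Metric.eball (x : E) (r x)) (fun _ => Metric.isOpen_eball)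
  have hcover : (⋃ x : s, Metric.eball (x : E) (r x)) = s :=
    (iUnion_subset hrs).antisymm fun x hx =>
      mem_iUnion.2 ⟨⟨x, hx⟩, Metric.mem_eball_self (hr _)⟩
  rw [← hcover, ← hTs, preimage_iUnion₂]
  exact MeasurableSet.biUnion hT fun x _ => measurableSet_lt (hg x) measurable_const

section Transpose

variable {α Y : Type*} [MeasurableSpace α] [MeasurableSpace Y] {μ : Measure α} {ν : Measure Y}

theorem edist_Lp_one_of_ae_eq {E : Type*} [NormedAddCommGroup E] {u v : Lp E 1 ν} {u' v' : Y → E}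
    (hu : u' =ᵐ[ν] u) (hv : v' =ᵐ[ν] v) : edist u v = ∫⁻ y, ‖u' y - v' y‖ₑ ∂ν := by
  rw [Lp.edist_def, eLpNorm_one_eq_lintegral_enorm]
  refine lintegral_congr_ae ?_
  filter_upwards [hu, hv] with y hu hv
  rw [hu, hv, Pi.sub_apply]

theorem edist_Lp_one {E : Type*} [NormedAddCommGroup E] {u v : Lp E 1 ν} :
    edist u v = ∫⁻ y, ‖u y - v y‖ₑ ∂ν :=
  edist_Lp_one_of_ae_eq .rfl .rfl

/-- `H` represents `f` as a function on the product: `H ∈ L¹(α × Y)`, and `H (x, ·)` is a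
representative of `f x ∈ L¹(Y)` for almost every `x`. -/
def IsJointFunction (μ : Measure α) (ν : Measure Y) (f : α → Lp ℝ 1 ν) (H : α × Y → ℝ) : Prop :=
  Integrable H (μ.prod ν) ∧ ∀ᵐ x ∂μ, (fun y => H (x, y)) =ᵐ[ν] f x

namespace IsJointFunction

theorem indicator_const [SFinite ν] (c : Lp ℝ 1 ν) {s : Set α} (hs : MeasurableSet s)
    (hμs : μ s ≠ ∞) :
    IsJointFunction μ ν (s.indicator fun _ => c) (fun p => s.indicator 1 p.1 * c p.2) := by
  have hind : Integrable (s.indicator 1 : α → ℝ) μ :=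
    (integrable_indicator_iff hs).2 (integrableOn_const hμs)
  refine ⟨hind.mul_prod (L1.integrable_coeFn c), Eventually.of_forall fun x => ?_⟩
  by_cases hx : x ∈ s
  · simp [hx]
  · simp only [indicator_of_notMem hx, zero_mul]
    exact (Lp.coeFn_zero ℝ 1 ν).symm

theorem add {f g : α → Lp ℝ 1 ν} {F G : α × Y → ℝ} (hF : IsJointFunction μ ν f F)
    (hG : IsJointFunction μ ν g G) : IsJointFunction μ ν (f + g) (F + G) := by
  refine ⟨hF.1.add hG.1, ?_⟩
  filter_upwards [hF.2, hG.2] with x hFx hGx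
  filter_upwards [hFx, hGx, Lp.coeFn_add (f x) (g x)] with y hFy hGy hadd
  rw [Pi.add_apply, Pi.add_apply, hadd, Pi.add_apply, hFy, hGy]

theorem congr_ae {f g : α → Lp ℝ 1 ν} {F : α × Y → ℝ} (hF : IsJointFunction μ ν f F)
    (hfg : f =ᵐ[μ] g) : IsJointFunction μ ν g F := by
  refine ⟨hF.1, ?_⟩
  filter_upwards [hfg, hF.2] with x hfg hFx
  rwa [← hfg]

theorem lintegral_enorm_sub [SFinite ν] {f g : α → Lp ℝ 1 ν} {F G : α × Y → ℝ}
    (hF : IsJointFunction μ ν f F) (hG : IsJointFunction μ ν g G) :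
    ∫⁻ p, ‖F p - G p‖ₑ ∂(μ.prod ν) = ∫⁻ x, ‖f x - g x‖ₑ ∂μ := by
  have hm : AEMeasurable (fun p => ‖F p - G p‖ₑ) (μ.prod ν) :=
    (hF.1.sub hG.1).aestronglyMeasurable.enorm
  rw [lintegral_prod _ hm]
  refine lintegral_congr_ae ?_
  filter_upwards [hF.2, hG.2] with x hFx hGx
  rw [← edist_eq_enorm_sub, edist_Lp_one_of_ae_eq hFx hGx]

theorem lintegral_enorm_sub_le [SFinite μ] [SFinite ν] {f : α → Lp ℝ 1 ν} {F G : α × Y → ℝ}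
    (hF : IsJointFunction μ ν f F) (hG : Integrable G (μ.prod ν)) (g : α → Lp ℝ 1 ν) :
    ∀ᵐ x ∂μ, ∫⁻ y, ‖G (x, y) - g x y‖ₑ ∂ν
      ≤ ∫⁻ y, ‖F (x, y) - G (x, y)‖ₑ ∂ν + ‖f x - g x‖ₑ := by
  filter_upwards [hF.2, hG.prod_right_ae, hF.1.prod_right_ae] with x hFx hGx hFxi
  calc ∫⁻ y, ‖G (x, y) - g x y‖ₑ ∂ν
      ≤ ∫⁻ y, (‖F (x, y) - G (x, y)‖ₑ + ‖F (x, y) - g x y‖ₑ) ∂ν := by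
        refine lintegral_mono fun y => ?_
        rw [← sub_sub_sub_cancel_left (g x y) (G (x, y)) (F (x, y)), add_comm]
        exact enorm_sub_le
    _ = ∫⁻ y, ‖F (x, y) - G (x, y)‖ₑ ∂ν + ‖f x - g x‖ₑ := by
        have hm : AEMeasurable (fun y => ‖F (x, y) - G (x, y)‖ₑ) ν :=
          (hFxi.sub hGx).aestronglyMeasurable.enorm
        rw [lintegral_add_left' hm, ← edist_Lp_one_of_ae_eq hFx .rfl, edist_eq_enorm_sub]

theorem of_tendsto [SFinite μ] [SFinite ν] {f : ℕ → α → Lp ℝ 1 ν} {H : ℕ → α × Y → ℝ}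
    {f₀ : α → Lp ℝ 1 ν} {H₀ : α × Y → ℝ} (hH : ∀ n, IsJointFunction μ ν (f n) (H n))
    (hH₀ : Integrable H₀ (μ.prod ν)) (hfm : ∀ n, AEStronglyMeasurable (f n - f₀) μ)
    (hf : Tendsto (fun n => ∫⁻ x, ‖f n x - f₀ x‖ₑ ∂μ) atTop (𝓝 0))
    (hlim : Tendsto (fun n => ∫⁻ p, ‖H n p - H₀ p‖ₑ ∂(μ.prod ν)) atTop (𝓝 0)) :
    IsJointFunction μ ν f₀ H₀ := by
  set G : ℕ → α → ℝ≥0∞ := fun n x => ∫⁻ y, ‖H n (x, y) - H₀ (x, y)‖ₑ ∂ν + ‖f n x - f₀ x‖ₑ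
  have hsub : ∀ n, AEMeasurable (fun p => ‖H n p - H₀ p‖ₑ) (μ.prod ν) := fun n =>
    ((hH n).1.sub hH₀).aestronglyMeasurable.enorm
  have hG : ∀ n, AEMeasurable (G n) μ := fun n =>
    (hsub n).lintegral_prod_right'.add (hfm n).enorm
  have hGint : ∀ n, ∫⁻ x, G n x ∂μ
      = ∫⁻ p, ‖H n p - H₀ p‖ₑ ∂(μ.prod ν) + ∫⁻ x, ‖f n x - f₀ x‖ₑ ∂μ := fun n => by
    rw [lintegral_add_left' (hsub n).lintegral_prod_right', lintegral_prod _ (hsub n)]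
  have hzero : ∫⁻ x, ⨅ n, G n x ∂μ = 0 := by
    refine le_antisymm (ge_of_tendsto' (add_zero (0 : ℝ≥0∞) ▸ hlim.add hf) fun n => ?_) zero_le
    exact (lintegral_mono fun x => iInf_le _ n).trans (hGint n).le
  rw [lintegral_eq_zero_iff' (AEMeasurable.iInf hG)] at hzero
  refine ⟨hH₀, ?_⟩
  filter_upwards [hzero, hH₀.prod_right_ae,
    ae_all_iff.2 fun n => (hH n).lintegral_enorm_sub_le hH₀ f₀] with x hx hxi hle
  have hD : ∫⁻ y, ‖H₀ (x, y) - f₀ x y‖ₑ ∂ν = 0 := le_antisymm ((le_iInf hle).trans hx.le) zero_le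
  have hm : AEMeasurable (fun y => ‖H₀ (x, y) - f₀ x y‖ₑ) ν :=
    (hxi.sub (L1.integrable_coeFn (f₀ x))).aestronglyMeasurable.enorm
  rw [lintegral_eq_zero_iff' hm] at hD
  filter_upwards [hD] with y hy
  exact sub_eq_zero.1 (enorm_eq_zero.1 hy)

theorem isClosed [SFinite μ] [SFinite ν] :
    IsClosed {f : Lp (Lp ℝ 1 ν) 1 μ | ∃ H, IsJointFunction μ ν f H} := by
  refine IsSeqClosed.isClosed fun f f₀ hf hlim => ?_
  choose H hH using hf
  have hisom : ∀ n m, edist (hH n).1.toL1 (hH m).1.toL1 = edist (f n) (f m) := fun n m => by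
    rw [edist_Lp_one_of_ae_eq (hH n).1.coeFn_toL1.symm (hH m).1.coeFn_toL1.symm,
      (hH n).lintegral_enorm_sub (hH m), edist_Lp_one]
  have hcauchy : CauchySeq fun n => (hH n).1.toL1 := by
    have hf := hlim.cauchySeq
    rw [EMetric.cauchySeq_iff] at hf ⊢
    simpa only [hisom] using hf
  obtain ⟨H₀, hH₀⟩ := cauchySeq_tendsto_of_complete hcauchy
  refine ⟨H₀, of_tendsto hH (L1.integrable_coeFn H₀)
    (fun n => (Lp.aestronglyMeasurable _).sub (Lp.aestronglyMeasurable _)) ?_ ?_⟩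
  · simpa only [tendsto_iff_edist_tendsto_0, edist_Lp_one] using hlim
  · simpa only [tendsto_iff_edist_tendsto_0,
      fun n => edist_Lp_one_of_ae_eq (hH n).1.coeFn_toL1.symm (EventuallyEq.refl _ H₀)] using hH₀

end IsJointFunction

theorem exists_isJointFunction [SFinite μ] [SFinite ν] {f : α → Lp ℝ 1 ν} (hf : MemLp f 1 μ) :
    ∃ H, IsJointFunction μ ν f H := by
  refine MemLp.induction ENNReal.one_ne_top (fun f => ∃ H, IsJointFunction μ ν f H) ?_ ?_
    IsJointFunction.isClosed ?_ hf
  · exact fun c s hs hμs => ⟨_, .indicator_const c hs hμs.ne⟩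
  · rintro f g - - - ⟨F, hF⟩ ⟨G, hG⟩
    exact ⟨F + G, hF.add hG⟩
  · rintro f g hfg - ⟨H, hH⟩
    exact ⟨H, hH.congr_ae hfg⟩

theorem isJointFunction_jointFunction [SFinite μ] [SFinite ν] {f : α → Lp ℝ 1 ν}
    (hf : MemLp f 1 μ) : IsJointFunction μ ν f (jointFunction μ ν f) := by
  have hex : ∃ H : α × Y → ℝ, Integrable H (μ.prod ν) ∧
      ∀ᵐ x ∂μ, (fun y => H (x, y)) =ᵐ[ν] f x := exists_isJointFunction hf
  rw [jointFunction, dif_pos hex]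
  exact hex.choose_spec

theorem ae_transpose_eq [SFinite μ] [SFinite ν] {f : α → Lp ℝ 1 ν} (hf : MemLp f 1 μ) :
    ∀ᵐ y ∂ν, transpose μ ν f y =ᵐ[μ] fun x => jointFunction μ ν f (x, y) := by
  filter_upwards [(isJointFunction_jointFunction hf).1.prod_left_ae] with y hy
  rw [transpose, dif_pos (memLp_one_iff_integrable.2 hy)]
  exact MemLp.coeFn_toLp _

open Classical in
theorem measurable_dite_toLp [SFinite μ] [SecondCountableTopology (Lp ℝ 1 μ)] {H : α × Y → ℝ}
    (hH : Measurable H) :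
    Measurable fun y => if h : MemLp (fun x => H (x, y)) 1 μ then h.toLp else 0 := by
  refine measurable_of_measurable_edist fun v => ?_
  have hv : Measurable v := (Lp.stronglyMeasurable v).measurable
  have hHs : Measurable fun p : Y × α => H (p.2, p.1) := hH.comp measurable_swap
  have hnorm : Measurable fun y => ∫⁻ x, ‖H (x, y)‖ₑ ∂μ := hHs.enorm.lintegral_prod_right'
  have hdist : Measurable fun y => ∫⁻ x, ‖H (x, y) - v x‖ₑ ∂μ :=
    (hHs.sub (hv.comp measurable_snd)).enorm.lintegral_prod_right'
  have hmem : ∀ y, MemLp (fun x => H (x, y)) 1 μ ↔ ∫⁻ x, ‖H (x, y)‖ₑ ∂μ < ∞ := fun y => by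
    rw [memLp_one_iff_integrable, Integrable, HasFiniteIntegral]
    exact and_iff_right (hH.comp (measurable_id.prodMk measurable_const)).aestronglyMeasurable
  have hite : Measurable fun y => if ∫⁻ x, ‖H (x, y)‖ₑ ∂μ < ∞ then ∫⁻ x, ‖H (x, y) - v x‖ₑ ∂μ
      else edist (0 : Lp ℝ 1 μ) v :=
    Measurable.ite (measurableSet_lt hnorm measurable_const) hdist measurable_const
  convert hite using 1
  funext y
  by_cases hy : MemLp (fun x => H (x, y)) 1 μ
  · rw [dif_pos hy, if_pos ((hmem y).1 hy), edist_Lp_one_of_ae_eq hy.coeFn_toLp.symm .rfl]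
  · rw [dif_neg hy, if_neg (mt (hmem y).2 hy)]

theorem exists_measurable_isJointFunction [SFinite μ] [SFinite ν] {f : α → Lp ℝ 1 ν}
    (hf : MemLp f 1 μ) : ∃ H, Measurable H ∧ IsJointFunction μ ν f H ∧
      ∀ᵐ y ∂ν, transpose μ ν f y =ᵐ[μ] fun x => H (x, y) := by
  have hJ := isJointFunction_jointFunction hf
  obtain ⟨H, hHm, hHe⟩ := id hJ.1.aestronglyMeasurable
  refine ⟨H, hHm.measurable, ⟨hJ.1.congr hHe, ?_⟩, ?_⟩
  · filter_upwards [hJ.2, Measure.ae_ae_of_ae_prod hHe] with x hfx hHx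
    exact EventuallyEq.trans (EventuallyEq.symm hHx) hfx
  · have hswap : ∀ᵐ p ∂ν.prod μ, jointFunction μ ν f p.swap = H p.swap :=
      (Measure.measurePreserving_swap (μ := ν) (ν := μ)).quasiMeasurePreserving.ae hHe
    filter_upwards [ae_transpose_eq hf, Measure.ae_ae_of_ae_prod hswap] with y hfy hHy
    exact hfy.trans hHy

theorem aemeasurable_transpose [SFinite μ] [SFinite ν] [SecondCountableTopology (Lp ℝ 1 μ)]
    {f : α → Lp ℝ 1 ν} (hf : MemLp f 1 μ) : AEMeasurable (transpose μ ν f) ν := by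
  classical
  obtain ⟨H, hHm, -, hHt⟩ := exists_measurable_isJointFunction hf
  refine ⟨_, measurable_dite_toLp (μ := μ) hHm, ?_⟩
  filter_upwards [hHt] with y hy
  rw [dif_pos ((Lp.memLp _).ae_eq hy)]
  exact Lp.ext (hy.trans (MemLp.coeFn_toLp _).symm)

end Transpose

section Slice

variable {α : Type*} [MeasurableSpace α] {μ : Measure α}

/-- The characteristic function of `sliceSet u t`, as a function of the value of `u`. -/
noncomputable def sliceInd (t a : ℝ) : ℝ := if (0 < t ∧ t ≤ a) ∨ (t < 0 ∧ a ≤ t) then 1 else 0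

theorem slice_coe_ae_eq (u : Lp ℝ 1 μ) (t : ℝ) :
    (slice (u, t)).1 =ᵐ[μ] fun x => sliceInd t (u x) := by
  have hind := indicatorConstLp_coeFn (p := 1) (c := (1 : ℝ))
    (hs := measurableSet_sliceSet (Lp.stronglyMeasurable u).measurable t)
    (hμs := measure_sliceSet_ne_top (Lp.memLp u) t)
  filter_upwards [hind] with x hx
  refine hx.trans ?_
  simp only [indicator, sliceSet, mem_ofPred_eq, sliceInd]
  congr

theorem lintegral_enorm_sliceInd_sub (a b : ℝ) :
    ∫⁻ t, ‖sliceInd t a - sliceInd t b‖ₑ = ‖a - b‖ₑ := by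
  wlog hab : a ≤ b generalizing a b
  · simpa only [enorm_sub_rev] using this b a (le_of_not_ge hab)
  rw [enorm_sub_rev, Real.enorm_of_nonneg (sub_nonneg.2 hab), ← Real.volume_Ioc,
    ← lintegral_indicator_one measurableSet_Ioc]
  refine lintegral_congr_ae ?_
  filter_upwards [Measure.ae_ne volume 0, Measure.ae_ne volume a, Measure.ae_ne volume b]
    with t h0 ha hb
  simp only [sliceInd, indicator, mem_Ioc, Pi.one_apply]
  rcases lt_or_gt_of_ne h0 with h | h <;> rcases lt_or_gt_of_ne ha with h' | h' <;>
    rcases lt_or_gt_of_ne hb with h'' | h'' <;>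
    simp [h, h.not_gt, h'.le, h'.not_ge, h''.le, h''.not_ge, h'.not_gt, h'] <;> linarith

theorem measurable_sliceInd : Measurable fun p : ℝ × ℝ => sliceInd p.1 p.2 := by
  refine Measurable.ite (p := fun p : ℝ × ℝ => (0 < p.1 ∧ p.1 ≤ p.2) ∨ (p.1 < 0 ∧ p.2 ≤ p.1)) ?_
    measurable_const measurable_const
  exact ((measurableSet_lt measurable_const measurable_fst).inter
    (measurableSet_le measurable_fst measurable_snd)).union
    ((measurableSet_lt measurable_fst measurable_const).inter
    (measurableSet_le measurable_snd measurable_fst))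

theorem sliceInd_eq_sliceInd_one (t a : ℝ) : sliceInd t a = sliceInd 1 (t⁻¹ * a) := by
  rcases lt_trichotomy t 0 with ht | rfl | ht
  · have hiff : 1 ≤ t⁻¹ * a ↔ a ≤ t := by rw [inv_mul_eq_div, one_le_div_of_neg ht]
    simp [sliceInd, ht, ht.not_gt, hiff, zero_le_one.not_gt]
  · simp [sliceInd, zero_le_one.not_gt]
  · have hiff : 1 ≤ t⁻¹ * a ↔ t ≤ a := by rw [inv_mul_eq_div, one_le_div ht]
    simp [sliceInd, ht, ht.not_gt, hiff, zero_le_one.not_gt]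

theorem sliceInd_one_of_one_le {a : ℝ} (ha : 1 ≤ a) : sliceInd 1 a = 1 := by
  simp [sliceInd, ha]

theorem sliceInd_one_of_lt_one {a : ℝ} (ha : a < 1) : sliceInd 1 a = 0 := by
  simp [sliceInd, ha.not_ge, zero_le_one.not_gt]

/-- A `(n + 1)`-Lipschitz approximation of the characteristic function of `[1, ∞)`, that is, of
`sliceInd 1`; it shows that slicing is Borel on `L¹`. -/
noncomputable def unitRamp (n : ℕ) (a : ℝ) : ℝ := max 0 (min 1 ((n + 1) * (a - 1) + 1))

theorem lipschitzWith_unitRamp (n : ℕ) : LipschitzWith (n + 1) (unitRamp n) := by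
  have haffine : LipschitzWith (n + 1) fun a : ℝ => ((n : ℝ) + 1) * (a - 1) + 1 := by
    refine LipschitzWith.of_dist_le_mul fun a b => ?_
    rw [Real.dist_eq, Real.dist_eq, add_sub_add_right_eq_sub, ← mul_sub, sub_sub_sub_cancel_right,
      abs_mul, abs_of_nonneg (by positivity : (0 : ℝ) ≤ n + 1)]
    simp
  exact (haffine.const_min 1).const_max 0

theorem unitRamp_zero (n : ℕ) : unitRamp n 0 = 0 :=
  max_eq_left ((min_le_right _ _).trans (by linarith [n.cast_nonneg (α := ℝ)]))

theorem unitRamp_of_one_le (n : ℕ) {a : ℝ} (ha : 1 ≤ a) : unitRamp n a = 1 := by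
  have hramp : 1 ≤ ((n : ℝ) + 1) * (a - 1) + 1 := by nlinarith [n.cast_nonneg (α := ℝ)]
  rw [unitRamp, min_eq_left hramp, max_eq_right zero_le_one]

theorem enorm_unitRamp_sub_le (n : ℕ) (a : ℝ) : ‖unitRamp n a - sliceInd 1 a‖ₑ ≤ ‖a‖ₑ := by
  rcases le_or_gt 1 a with ha | ha
  · simp [unitRamp_of_one_le n ha, sliceInd_one_of_one_le ha]
  · have hramp : ((n : ℝ) + 1) * (a - 1) + 1 ≤ a := by nlinarith [n.cast_nonneg (α := ℝ)]
    rw [sliceInd_one_of_lt_one ha, sub_zero, enorm_le_iff_norm_le, Real.norm_eq_abs,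
      Real.norm_eq_abs, unitRamp, abs_of_nonneg (le_max_left _ _)]
    exact max_le (abs_nonneg _) ((min_le_right _ _).trans (hramp.trans (le_abs_self a)))

theorem tendsto_unitRamp (a : ℝ) :
    Tendsto (fun n => ‖unitRamp n a - sliceInd 1 a‖ₑ) atTop (𝓝 0) := by
  refine tendsto_const_nhds.congr' ?_
  rcases le_or_gt 1 a with ha | ha
  · exact Eventually.of_forall fun n => by
      simp [unitRamp_of_one_le n ha, sliceInd_one_of_one_le ha]
  · obtain ⟨N, hN⟩ := exists_nat_gt (1 - a)⁻¹
    filter_upwards [eventually_ge_atTop N] with n hn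
    have hnN : (1 - a)⁻¹ ≤ n := hN.le.trans (by exact_mod_cast hn)
    rw [inv_le_iff_one_le_mul₀ (by linarith)] at hnN
    have hramp : ((n : ℝ) + 1) * (a - 1) + 1 ≤ 0 := by nlinarith
    simp [unitRamp, sliceInd_one_of_lt_one ha, hramp]

theorem measurable_slice_one [SecondCountableTopology (Lp ℝ 1 μ)] :
    Measurable fun u : Lp ℝ 1 μ => (slice (u, 1)).1 := by
  refine measurable_of_tendsto_metrizable
    (f := fun n => (lipschitzWith_unitRamp n).compLp (unitRamp_zero n)) (fun n =>
      ((lipschitzWith_unitRamp n).continuous_compLp (unitRamp_zero n)).measurable) ?_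
  rw [tendsto_pi_nhds]
  intro u
  rw [tendsto_iff_edist_tendsto_0]
  have hum : Measurable u := (Lp.stronglyMeasurable u).measurable
  have hedist : ∀ n, edist ((lipschitzWith_unitRamp n).compLp (unitRamp_zero n) u) (slice (u, 1)).1
      = ∫⁻ x, ‖unitRamp n (u x) - sliceInd 1 (u x)‖ₑ ∂μ := fun n =>
    edist_Lp_one_of_ae_eq ((lipschitzWith_unitRamp n).coeFn_compLp (unitRamp_zero n) u).symm
      (slice_coe_ae_eq u 1).symm
  simp only [hedist]
  rw [← lintegral_zero (μ := μ)]
  refine tendsto_lintegral_of_dominated_convergence (fun x => ‖u x‖ₑ) (fun n => ?_)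
    (fun n => Eventually.of_forall fun x => enorm_unitRamp_sub_le n (u x))
    (L1.integrable_coeFn u).2.ne (Eventually.of_forall fun x => tendsto_unitRamp (u x))
  exact (((lipschitzWith_unitRamp n).continuous.measurable.comp hum).sub
    (measurable_sliceInd.comp (measurable_const.prodMk hum))).enorm

theorem measurable_slice [SecondCountableTopology (Lp ℝ 1 μ)] :
    Measurable (slice : Lp ℝ 1 μ × ℝ → Cut μ) := by
  have hscale : (fun q : Lp ℝ 1 μ × ℝ => (slice q).1) = fun q => (slice (q.2⁻¹ • q.1, 1)).1 := by
    funext q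
    refine Lp.ext ?_
    filter_upwards [slice_coe_ae_eq q.1 q.2, slice_coe_ae_eq (q.2⁻¹ • q.1) 1,
      Lp.coeFn_smul q.2⁻¹ q.1] with x hq hq₁ hsmul
    rw [hq₁, hsmul, Pi.smul_apply, smul_eq_mul, ← sliceInd_eq_sliceInd_one, ← hq]
  have hmeas : Measurable fun q : Lp ℝ 1 μ × ℝ => (slice q).1 :=
    hscale ▸ measurable_slice_one.comp (measurable_snd.inv.smul measurable_fst)
  exact hmeas.subtype_mk

end Slice

section CutMeasure

variable {α Y : Type*} [MeasurableSpace α] [MeasurableSpace Y] {μ : Measure α} {ν : Measure Y}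

theorem lintegral_cutMeasure [SFinite μ] [SFinite ν] [SecondCountableTopology (Lp ℝ 1 μ)]
    {f : α → Lp ℝ 1 ν} (hf : MemLp f 1 μ) {P : Cut μ → ℝ≥0∞} (hP : Measurable P) :
    ∫⁻ E, P E ∂cutMeasure μ ν f = ∫⁻ y, (∫⁻ t : ℝ, P (slice (transpose μ ν f y, t))) ∂ν := by
  have : SFinite (tautMeasure μ ν f) := by rw [tautMeasure]; infer_instance
  have hPs : Measurable fun q : Lp ℝ 1 μ × ℝ => P (slice q) := hP.comp measurable_slice
  rw [cutMeasure, lintegral_map hP measurable_slice, lintegral_prod _ hPs.aemeasurable, tautMeasure]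
  exact lintegral_map' hPs.lintegral_prod_right'.aemeasurable (aemeasurable_transpose hf)

theorem lintegral_cutMeasure_le (f : α → Lp ℝ 1 ν) (P : Cut μ → ℝ≥0∞) :
    ∫⁻ E, P E ∂cutMeasure μ ν f ≤ ∫⁻ y, (∫⁻ t : ℝ, P (slice (transpose μ ν f y, t))) ∂ν :=
  (lintegral_map_le _ _).trans ((lintegral_prod_le _).trans (lintegral_map_le _ _))

theorem lintegral_doubleOsc [SFinite μ] [SFinite ν] {G : Y → α → ℝ} (B : Set α)
    (hG : Measurable (Function.uncurry G)) :
    ∫⁻ y, doubleOsc μ B (G y) ∂ν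
      = ∫⁻ z in B, ∫⁻ w in B, ∫⁻ y, ‖G y z - G y w‖ₑ ∂ν ∂μ ∂μ := by
  have hm : Measurable fun p : (Y × α) × α => ‖G p.1.1 p.1.2 - G p.1.1 p.2‖ₑ :=
    ((hG.comp measurable_fst).sub
      (hG.comp ((measurable_fst.comp measurable_fst).prodMk measurable_snd))).enorm
  simp only [doubleOsc]
  rw [lintegral_lintegral_swap hm.lintegral_prod_right'.aemeasurable]
  refine lintegral_congr fun z => ?_
  rw [lintegral_lintegral_swap]
  exact (hm.comp ((measurable_fst.prodMk measurable_const).prodMk measurable_snd)).aemeasurable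

theorem lintegral_doubleOsc_slice [SFinite μ] {B U : Set α} (hB : B ⊆ U)
    (u : Lp ℝ 1 (μ.restrict U)) :
    ∫⁻ t, doubleOsc μ B (slice (u, t)).1 = doubleOsc μ B u := by
  have hu : Measurable u := (Lp.stronglyMeasurable u).measurable
  have hslice : ∀ t, doubleOsc μ B (slice (u, t)).1 = doubleOsc μ B (fun x => sliceInd t (u x)) :=
    fun t => doubleOsc_congr (ae_restrict_of_ae_restrict_of_subset hB (slice_coe_ae_eq u t))
  have hmeas : Measurable (Function.uncurry fun t x => sliceInd t (u x)) :=
    measurable_sliceInd.comp (measurable_fst.prodMk (hu.comp measurable_snd))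
  rw [lintegral_congr hslice, lintegral_doubleOsc B hmeas]
  simp only [lintegral_enorm_sliceInd_sub, doubleOsc]

theorem continuous_doubleOsc {B U : Set α} (hB : B ⊆ U) (hμB : μ B ≠ ∞) :
    Continuous fun u : Lp ℝ 1 (μ.restrict U) => doubleOsc μ B u := by
  refine continuous_of_le_add_edist (2 * μ B) (ENNReal.mul_ne_top (by simp) hμB) fun u v => ?_
  have hBU : μ.restrict B ≤ μ.restrict U := Measure.restrict_mono hB le_rfl
  refine (doubleOsc_le_add (v := v) (((Lp.aestronglyMeasurable u).sub
    (Lp.aestronglyMeasurable v)).mono_measure hBU)).trans ?_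
  rw [edist_Lp_one]
  gcongr

theorem lintegral_doubleOsc_transpose [SFinite μ] [SFinite ν] {B U : Set α} (hB : B ⊆ U)
    {f : α → Lp ℝ 1 ν} (hf : MemLp f 1 (μ.restrict U)) :
    ∫⁻ y, doubleOsc μ B (transpose (μ.restrict U) ν f y) ∂ν = doubleOsc μ B f := by
  obtain ⟨H, hHm, hHf, hHt⟩ := exists_measurable_isJointFunction hf
  have hHB := ae_restrict_of_ae_restrict_of_subset hB hHf.2
  calc ∫⁻ y, doubleOsc μ B (transpose (μ.restrict U) ν f y) ∂ν
      = ∫⁻ y, doubleOsc μ B (fun x => H (x, y)) ∂ν := by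
        refine lintegral_congr_ae ?_
        filter_upwards [hHt] with y hy
        exact doubleOsc_congr (ae_restrict_of_ae_restrict_of_subset hB hy)
    _ = ∫⁻ z in B, ∫⁻ w in B, ∫⁻ y, ‖H (z, y) - H (w, y)‖ₑ ∂ν ∂μ ∂μ :=
        lintegral_doubleOsc B (G := fun y x => H (x, y)) (hHm.comp measurable_swap)
    _ = doubleOsc μ B f := by
        refine lintegral_congr_ae ?_
        filter_upwards [hHB] with z hz
        refine lintegral_congr_ae ?_
        filter_upwards [hHB] with w hw
        rw [← edist_eq_enorm_sub, edist_Lp_one_of_ae_eq hz hw]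

theorem lintegral_doubleOsc_cutMeasure [SFinite μ] [SFinite ν] {B U : Set α} (hB : B ⊆ U)
    (hμB : μ B ≠ ∞) [SecondCountableTopology (Lp ℝ 1 (μ.restrict U))]
    {f : α → Lp ℝ 1 ν} (hf : MemLp f 1 (μ.restrict U)) :
    ∫⁻ E, doubleOsc μ B E.1 ∂cutMeasure (μ.restrict U) ν f = doubleOsc μ B f := by
  have hP : Measurable fun E : Cut (μ.restrict U) => doubleOsc μ B E.1 :=
    (continuous_doubleOsc hB hμB).measurable.comp measurable_subtype_coe
  rw [lintegral_cutMeasure hf hP]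
  simp only [lintegral_doubleOsc_slice hB, lintegral_doubleOsc_transpose hB hf]

theorem IsPIMeasure.doubleOsc_le_totalPerimeter {X : Type*} [MetricSpace X] [MeasurableSpace X]
    [BorelSpace X] {μ : Measure X} {R : ℝ≥0∞} {β Λ τ : ℝ≥0} [SFinite ν]
    (h : IsPIMeasure μ R β Λ τ) {U : Set X} {f : X → Lp ℝ 1 ν} (hf : MemLp f 1 (μ.restrict U))
    {x : X} {s : ℝ} (hs : 0 < s) (hsR : ENNReal.ofReal s ≤ R) {W : Set X} (hW : IsOpen W)
    (hsW : ball x s ⊆ W) (hΛW : closedBall x (Λ * s) ⊆ W) (hWU : W ⊆ U) :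
    doubleOsc μ (ball x s) f ≤ 2 * μ (ball x s) * (ENNReal.ofReal s * (τ + 1)) *
      totalPerimeter μ U (cutMeasure (μ.restrict U) ν f) W := by
  have := h.sigmaFinite
  have := h.secondCountableTopology
  have : Fact ((1 : ℝ≥0∞) ≠ ∞) := ⟨ENNReal.one_ne_top⟩
  have hμs : μ (ball x s) ≠ ∞ := (h.ball_lt_top x s).ne
  have hfactor : 2 * μ (ball x s) * (ENNReal.ofReal s * (τ + 1)) ≠ ∞ := by finiteness
  rw [← lintegral_doubleOsc_cutMeasure (hsW.trans hWU) hμs hf, totalPerimeter,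
    ← lintegral_const_mul' _ _ hfactor]
  refine lintegral_mono fun E => ?_
  rw [perimeterMeasure_of_isOpen hW hWU]
  exact h.doubleOsc_le_variation hs hsR hW hsW hΛW
    (IntegrableOn.mono_set (L1.integrable_coeFn E.1) hWU)

end CutMeasure

section Dyadic

variable {E : Type*} [NormedAddCommGroup E] {a : ℝ → E} {G s₀ : ℝ}

theorem norm_sub_le_of_dyadic
    (ha : ∀ s s', 0 < s → s ≤ s₀ → s / 2 ≤ s' → s' ≤ s → ‖a s' - a s‖ ≤ G * s) {s s' : ℝ}
    (hs' : 0 < s') (hs's : s' ≤ s) (hss₀ : s ≤ s₀) : ‖a s' - a s‖ ≤ 2 * G * s := by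
  have hs : 0 < s := hs'.trans_le hs's
  obtain ⟨n, hn⟩ := exists_pow_lt_of_lt_one (div_pos hs' hs) (by norm_num : (1 / 2 : ℝ) < 1)
  replace hn : s / 2 ^ n ≤ s' := by
    rw [lt_div_iff₀ hs, one_div, inv_pow, inv_mul_eq_div] at hn
    exact hn.le
  clear hs'
  induction n generalizing s with
  | zero =>
    obtain rfl : s' = s := hs's.antisymm (by simpa using hn)
    have hGs := (norm_nonneg _).trans (ha s' s' hs hss₀ (by linarith) le_rfl)
    rw [sub_self, norm_zero, mul_assoc]
    exact mul_nonneg zero_le_two hGs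
  | succ n ih =>
    have hhalf := ha s (s / 2) hs hss₀ le_rfl (by linarith)
    rcases le_or_gt (s / 2) s' with hle | hlt
    · linarith [ha s s' hs hss₀ hle hs's, (norm_nonneg _).trans hhalf]
    · have hrec := ih hlt.le (by linarith) (by linarith) (by rwa [div_div, ← pow_succ'])
      calc ‖a s' - a s‖ ≤ ‖a s' - a (s / 2)‖ + ‖a (s / 2) - a s‖ :=
            norm_sub_le_norm_sub_add_norm_sub ..
        _ ≤ 2 * G * (s / 2) + G * s := add_le_add hrec hhalf
        _ = 2 * G * s := by ring

theorem norm_sub_le_of_tendsto_of_dyadic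
    (ha : ∀ s s', 0 < s → s ≤ s₀ → s / 2 ≤ s' → s' ≤ s → ‖a s' - a s‖ ≤ G * s) (hs₀ : 0 < s₀)
    {v : E} (hv : Tendsto a (𝓝[>] 0) (𝓝 v)) : ‖v - a s₀‖ ≤ 2 * G * s₀ := by
  refine le_of_tendsto (hv.sub_const (a s₀)).norm ?_
  filter_upwards [Ioc_mem_nhdsGT hs₀] with s hs
  exact norm_sub_le_of_dyadic ha hs.1 hs.2 le_rfl

theorem exists_tendsto_of_dyadic [CompleteSpace E]
    (ha : ∀ s s', 0 < s → s ≤ s₀ → s / 2 ≤ s' → s' ≤ s → ‖a s' - a s‖ ≤ G * s) (hs₀ : 0 < s₀) :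
    ∃ v, Tendsto a (𝓝[>] 0) (𝓝 v) := by
  refine cauchy_map_iff_exists_tendsto.1 (Metric.cauchy_iff.2 ⟨inferInstance, fun ε hε => ?_⟩)
  have hlim : Tendsto (fun s => 4 * G * s) (𝓝[>] 0) (𝓝 0) := by
    simpa using (tendsto_id.const_mul (4 * G)).mono_left (nhdsWithin_le_nhds (a := (0 : ℝ)))
  obtain ⟨s, ⟨hs, hss₀⟩, hsε⟩ :=
    ((eventually_mem_set.2 (Ioc_mem_nhdsGT hs₀)).and (hlim.eventually_lt_const hε)).exists
  refine ⟨a '' Ioc 0 s, image_mem_map (Ioc_mem_nhdsGT hs), ?_⟩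
  rintro - ⟨s₁, hs₁, rfl⟩ - ⟨s₂, hs₂, rfl⟩
  calc dist (a s₁) (a s₂) ≤ ‖a s₁ - a s‖ + ‖a s₂ - a s‖ := by
        simpa only [dist_eq_norm] using dist_triangle_right (a s₁) (a s₂) (a s)
    _ ≤ 2 * G * s + 2 * G * s := add_le_add (norm_sub_le_of_dyadic ha hs₁.1 hs₁.2 hss₀)
        (norm_sub_le_of_dyadic ha hs₂.1 hs₂.2 hss₀)
    _ < ε := by linarith

end Dyadic

section Average

variable {X E : Type*} [MeasurableSpace X] [NormedAddCommGroup E] [NormedSpace ℝ E]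
  [CompleteSpace E] {μ : Measure X}

theorem measure_mul_enorm_setAverage_sub_le {B : Set X} (hB : μ B ≠ ∞) {f : X → E}
    (hf : IntegrableOn f B μ) (c : E) :
    μ B * ‖(⨍ z in B, f z ∂μ) - c‖ₑ ≤ ∫⁻ z in B, ‖f z - c‖ₑ ∂μ :=
  calc μ B * ‖(⨍ z in B, f z ∂μ) - c‖ₑ = ‖μ.real B • ((⨍ z in B, f z ∂μ) - c)‖ₑ := by
        rw [enorm_smul, Real.enorm_of_nonneg measureReal_nonneg, ofReal_measureReal hB]
    _ = ‖∫ z in B, (f z - c) ∂μ‖ₑ := by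
        rw [smul_sub, measure_smul_setAverage _ hB, integral_sub hf (integrableOn_const hB),
          setIntegral_const]
    _ ≤ ∫⁻ z in B, ‖f z - c‖ₑ ∂μ := enorm_integral_le_lintegral_enorm _

theorem measure_mul_enorm_setAverage_sub_setAverage_le {B B' : Set X} (hB : μ B ≠ ∞) (hBB : B' ⊆ B)
    {f : X → E} (hf : IntegrableOn f B μ) :
    μ B * (μ B' * ‖(⨍ z in B', f z ∂μ) - ⨍ z in B, f z ∂μ‖ₑ) ≤ doubleOsc μ B f := by
  have hB' : μ B' ≠ ∞ := ne_top_of_le_ne_top hB (measure_mono hBB)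
  calc μ B * (μ B' * ‖(⨍ z in B', f z ∂μ) - ⨍ z in B, f z ∂μ‖ₑ)
      ≤ μ B * ∫⁻ z in B', ‖f z - ⨍ w in B, f w ∂μ‖ₑ ∂μ := by
        gcongr
        exact measure_mul_enorm_setAverage_sub_le hB' (hf.mono_set hBB) _
    _ = ∫⁻ z in B', μ B * ‖f z - ⨍ w in B, f w ∂μ‖ₑ ∂μ := (lintegral_const_mul' _ _ hB).symm
    _ ≤ ∫⁻ z in B', ∫⁻ w in B, ‖f z - f w‖ₑ ∂μ ∂μ := by
        refine lintegral_mono fun z => ?_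
        simp only [enorm_sub_rev (f z)]
        exact measure_mul_enorm_setAverage_sub_le hB hf _
    _ ≤ doubleOsc μ B f := lintegral_mono_set hBB

theorem enorm_setAverage_sub_setAverage_le {B B' : Set X} (hB₀ : μ B ≠ 0) (hB : μ B ≠ ∞)
    (hBB : B' ⊆ B) {D K : ℝ≥0∞} (hD : μ B ≤ D * μ B') {f : X → E} (hf : IntegrableOn f B μ)
    (hosc : doubleOsc μ B f ≤ K * μ B ^ 2) :
    ‖(⨍ z in B', f z ∂μ) - ⨍ z in B, f z ∂μ‖ₑ ≤ K * D := by
  have hB' : μ B' ≠ ∞ := ne_top_of_le_ne_top hB (measure_mono hBB)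
  have hB'₀ : μ B' ≠ 0 := fun hzero => hB₀ (by simpa [hzero] using hD)
  rw [← ENNReal.mul_le_mul_iff_right hB'₀ hB', ← ENNReal.mul_le_mul_iff_right hB₀ hB]
  calc μ B * (μ B' * ‖(⨍ z in B', f z ∂μ) - ⨍ z in B, f z ∂μ‖ₑ)
      ≤ K * μ B ^ 2 := (measure_mul_enorm_setAverage_sub_setAverage_le hB hBB hf).trans hosc
    _ = μ B * (K * μ B) := by ring
    _ ≤ μ B * (K * (D * μ B')) := by gcongr
    _ = μ B * (μ B' * (K * D)) := by ring

end Average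

section Representative

/-- The scales `s > 0` for which `ball x (N * s)` is contained in `U` and has radius at most `R`;
these are the scales at which the oscillation of a function on `U` is controlled. -/
def admissibleScales {X : Type*} [PseudoMetricSpace X] (R : ℝ≥0∞) (U : Set X) (N : ℝ) (x : X) :
    Set ℝ :=
  {s | 0 < s ∧ ENNReal.ofReal (N * s) ≤ R ∧ ball x (N * s) ⊆ U}

theorem mem_admissibleScales_of_le {X : Type*} [PseudoMetricSpace X] {R : ℝ≥0∞} {U : Set X} {N : ℝ}
    {x : X} {s s' : ℝ} (hN : 0 ≤ N) (hs' : 0 < s') (hs's : s' ≤ s)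
    (hs : s ∈ admissibleScales R U N x) : s' ∈ admissibleScales R U N x :=
  ⟨hs', (ENNReal.ofReal_le_ofReal (by gcongr)).trans hs.2.1,
    (ball_subset_ball (by gcongr)).trans hs.2.2⟩

theorem admissibleScales_nonempty {X : Type*} [PseudoMetricSpace X] {R : ℝ≥0∞} (hR : 0 < R)
    {U : Set X} (hU : IsOpen U) {N : ℝ} (hN : 0 < N) {x : X} (hx : x ∈ U) :
    (admissibleScales R U N x).Nonempty := by
  obtain ⟨ε, hε, hεU⟩ := Metric.isOpen_iff.1 hU x hx
  obtain ⟨ρ, hρ0, hρR⟩ := ENNReal.lt_iff_exists_nnreal_btwn.1 hR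
  have hρ : (0 : ℝ) < ρ := by exact_mod_cast hρ0
  have hcancel : N * (min ε ρ / N) = min ε ρ := by field_simp
  refine ⟨min ε ρ / N, by positivity, ?_, ?_⟩ <;> rw [hcancel]
  · exact (ENNReal.ofReal_le_of_le_toReal (min_le_right _ _)).trans hρR.le
  · exact (ball_subset_ball (min_le_left _ _)).trans hεU

theorem closedBall_subset_of_mem_admissibleScales {X : Type*} [PseudoMetricSpace X] {R : ℝ≥0∞}
    {U : Set X} {N : ℝ} {x : X} {s : ℝ} (hN : 1 < N) (hs : s ∈ admissibleScales R U N x) :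
    closedBall x s ⊆ U :=
  (closedBall_subset_ball (lt_mul_of_one_lt_left hs.1 hN)).trans hs.2.2

variable {X E : Type*} [MetricSpace X] [MeasurableSpace X] [NormedAddCommGroup E]
  [NormedSpace ℝ E] [CompleteSpace E] {μ : Measure X} {R : ℝ≥0∞} {β Λ τ : ℝ≥0} {U : Set X}
  {f : X → E} {N : ℝ} {M : ℝ≥0}

theorem IsPIMeasure.norm_setAverage_closedBall_sub_le (h : IsPIMeasure μ R β Λ τ)
    (hf : IntegrableOn f U μ) (hN : 4 ≤ N)
    (hosc : ∀ x, ∀ s ∈ admissibleScales R U N x,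
      doubleOsc μ (closedBall x s) f ≤ M * ENNReal.ofReal s * μ (closedBall x s) ^ 2)
    {x y : X} {s s' : ℝ} (hs : s ∈ admissibleScales R U N x) (hs' : 0 < s') (hs's : s' ≤ s)
    (hyx : closedBall y s' ⊆ closedBall x s) (hxy : closedBall x s ⊆ ball y (4 * s')) :
    ‖(⨍ z in closedBall y s', f z ∂μ) - ⨍ z in closedBall x s, f z ∂μ‖ ≤ M * β ^ 2 * s := by
  have hs0 : 0 < s := hs.1
  have hsU := closedBall_subset_of_mem_admissibleScales (by linarith) hs
  have hpos : μ (closedBall x s) ≠ 0 :=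
    ((h.ball_pos x s hs0).trans_le (measure_mono ball_subset_closedBall)).ne'
  have hfin : μ (closedBall x s) ≠ ∞ :=
    ((measure_mono hxy).trans_lt (h.ball_lt_top y _)).ne
  have hdoubling : μ (closedBall x s) ≤ (β : ℝ≥0∞) ^ 2 * μ (closedBall y s') := by
    calc μ (closedBall x s) ≤ μ (ball y (2 ^ 2 * s')) := measure_mono (by norm_num; exact hxy)
      _ ≤ (β : ℝ≥0∞) ^ 2 * μ (ball y s') := by
          refine h.measure_ball_two_pow_mul_le y 2 hs' (le_trans ?_ hs.2.1)
          exact ENNReal.ofReal_le_ofReal (by norm_num; gcongr)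
      _ ≤ (β : ℝ≥0∞) ^ 2 * μ (closedBall y s') := by gcongr; exact ball_subset_closedBall
  have hbound := enorm_setAverage_sub_setAverage_le hpos hfin hyx hdoubling (hf.mono_set hsU)
    (hosc x s hs)
  have hreal : (M : ℝ≥0∞) * ENNReal.ofReal s * β ^ 2 = ENNReal.ofReal (M * β ^ 2 * s) := by
    rw [ENNReal.ofReal_mul (by positivity), ENNReal.ofReal_mul M.coe_nonneg,
      ENNReal.ofReal_pow β.coe_nonneg, ENNReal.ofReal_coe_nnreal, ENNReal.ofReal_coe_nnreal,
      mul_right_comm]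
  rw [hreal, ← ofReal_norm] at hbound
  exact (ENNReal.ofReal_le_ofReal_iff (by positivity)).1 hbound

theorem IsPIMeasure.exists_tendsto_setAverage_closedBall (h : IsPIMeasure μ R β Λ τ) (hR : 0 < R)
    (hU : IsOpen U) (hf : IntegrableOn f U μ) (hN : 4 ≤ N)
    (hosc : ∀ x, ∀ s ∈ admissibleScales R U N x,
      doubleOsc μ (closedBall x s) f ≤ M * ENNReal.ofReal s * μ (closedBall x s) ^ 2)
    {x : X} (hx : x ∈ U) :
    ∃ v, Tendsto (fun s => ⨍ z in closedBall x s, f z ∂μ) (𝓝[>] 0) (𝓝 v) ∧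
      ∀ s ∈ admissibleScales R U N x,
        ‖v - ⨍ z in closedBall x s, f z ∂μ‖ ≤ 2 * (M * β ^ 2) * s := by
  have hdyadic : ∀ s₀ ∈ admissibleScales R U N x, ∀ s s', 0 < s → s ≤ s₀ → s / 2 ≤ s' → s' ≤ s →
      ‖(⨍ z in closedBall x s', f z ∂μ) - ⨍ z in closedBall x s, f z ∂μ‖ ≤ M * β ^ 2 * s := by
    intro s₀ hs₀ s s' hs hss₀ hhalf hs's
    exact h.norm_setAverage_closedBall_sub_le hf hN hosc
      (mem_admissibleScales_of_le (by linarith) hs hss₀ hs₀) (by linarith) hs's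
      (closedBall_subset_closedBall hs's) (closedBall_subset_ball (by linarith))
  obtain ⟨s₁, hs₁⟩ := admissibleScales_nonempty hR hU (by linarith : 0 < N) hx
  obtain ⟨v, hv⟩ := exists_tendsto_of_dyadic (hdyadic s₁ hs₁) hs₁.1
  exact ⟨v, hv, fun s hs => norm_sub_le_of_tendsto_of_dyadic (hdyadic s hs) hs.1 hv⟩

theorem IsPIMeasure.ae_tendsto_setAverage_closedBall [BorelSpace X] (h : IsPIMeasure μ R β Λ τ)
    (hR : 0 < R) (hU : IsOpen U) (hf : IntegrableOn f U μ) :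
    ∀ᵐ x ∂μ.restrict U, Tendsto (fun s => ⨍ z in closedBall x s, f z ∂μ) (𝓝[>] 0) (𝓝 (f x)) := by
  have := h.secondCountableTopology
  have := h.isLocallyFiniteMeasure
  have := h.isUnifLocDoublingMeasure hR
  have hloc : LocallyIntegrable (U.indicator f) μ :=
    ((integrable_indicator_iff hU.measurableSet).2 hf).locallyIntegrable
  rw [ae_restrict_iff' hU.measurableSet]
  filter_upwards [IsUnifLocDoublingMeasure.ae_tendsto_average μ hloc 1] with x hx hxU
  obtain ⟨ε, hε, hεU⟩ := Metric.isOpen_iff.1 hU x hxU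
  have hlim : Tendsto (fun s => ⨍ z in closedBall x s, U.indicator f z ∂μ) (𝓝[>] 0)
      (𝓝 (U.indicator f x)) := by
    refine hx (fun _ => x) (fun s => s) tendsto_id ?_
    filter_upwards [self_mem_nhdsWithin] with s hs
    exact mem_closedBall_self (by rw [one_mul]; exact (mem_Ioi.1 hs).le)
  rw [indicator_of_mem hxU] at hlim
  refine hlim.congr' ?_
  filter_upwards [Ioo_mem_nhdsGT hε] with s hs
  refine setAverage_congr_fun measurableSet_closedBall (Eventually.of_forall fun z hz => ?_)
  exact indicator_of_mem (hεU (closedBall_subset_ball hs.2 hz)) f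

theorem IsPIMeasure.exists_lipschitz_representative [BorelSpace X] (h : IsPIMeasure μ R β Λ τ)
    (hR : 0 < R) (hU : IsOpen U) (hf : IntegrableOn f U μ) (hN : 4 ≤ N)
    (hosc : ∀ x, ∀ s ∈ admissibleScales R U N x,
      doubleOsc μ (closedBall x s) f ≤ M * ENNReal.ofReal s * μ (closedBall x s) ^ 2) :
    ∃ F : X → E, F =ᵐ[μ.restrict U] f ∧ ∀ x ∈ U, ∀ y ∈ U,
      ENNReal.ofReal (2 * N * dist x y) ≤ R → ball x (2 * N * dist x y) ⊆ U →
      dist (F x) (F y) ≤ 8 * (M * β ^ 2) * dist x y := by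
  have hlim := fun x (hx : x ∈ U) => h.exists_tendsto_setAverage_closedBall hR hU hf hN hosc hx
  choose! F hFlim hF using hlim
  refine ⟨F, ?_, fun x hx y hy hxyR hxyU => ?_⟩
  · filter_upwards [h.ae_tendsto_setAverage_closedBall hR hU hf,
      ae_restrict_mem hU.measurableSet] with x hx hxU
    exact tendsto_nhds_unique (hFlim x hxU) hx
  · rcases eq_or_ne x y with rfl | hxy
    · simp
    set d := dist x y with hd
    have hd0 : 0 < d := dist_pos.2 hxy
    have hscale : N * (2 * d) = 2 * N * d := by ring
    have hsx : 2 * d ∈ admissibleScales R U N x :=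
      ⟨by positivity, by rwa [hscale], by rwa [hscale]⟩
    have hsy : d ∈ admissibleScales R U N y := by
      refine ⟨hd0, (ENNReal.ofReal_le_ofReal (by nlinarith)).trans hxyR,
        (ball_subset_ball' ?_).trans hxyU⟩
      rw [dist_comm, ← hd]
      nlinarith
    have hmid := h.norm_setAverage_closedBall_sub_le hf hN hosc (y := y) hsx hd0 (by linarith)
      (closedBall_subset_closedBall' (by rw [dist_comm]; linarith))
      (closedBall_subset_ball' (by linarith))
    rw [← dist_eq_norm, dist_comm] at hmid
    have hFx := hF x hx _ hsx
    have hFy := hF y hy _ hsy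
    rw [← dist_eq_norm] at hFx hFy
    rw [dist_comm] at hFy
    linarith [dist_triangle4 (F x) (⨍ z in closedBall x (2 * d), f z ∂μ)
      (⨍ z in closedBall y d, f z ∂μ) (F y)]

end Representative

section Chaining

theorem edist_le_mul_eVariationOn {X E : Type*} [PseudoEMetricSpace X] [PseudoEMetricSpace E]
    {F : X → E} {a b : ℝ} (hab : a ≤ b) {γ : ℝ → X} (hγ : ContinuousOn γ (Icc a b)) {K δ : ℝ≥0∞}
    (hδ : 0 < δ)
    (hF : ∀ s ∈ Icc a b, ∀ t ∈ Icc a b, edist (γ s) (γ t) < δ →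
      edist (F (γ s)) (F (γ t)) ≤ K * edist (γ s) (γ t)) :
    edist (F (γ a)) (F (γ b)) ≤ K * eVariationOn γ (Icc a b) := by
  have hγ' : Continuous fun s : Icc a b => γ s := continuousOn_iff_continuous_domRestrict.1 hγ
  obtain ⟨t, ht0, htmono, ⟨n, htn⟩, ht⟩ := exists_monotone_Icc_subset_open_cover_Icc hab
    (c := fun p : Icc a b => {q : Icc a b | edist (γ q) (γ p) < δ / 2})
    (fun p => isOpen_lt (hγ'.edist continuous_const) continuous_const)
    (fun p _ => mem_iUnion.2 ⟨p, by simpa using ENNReal.half_pos hδ.ne'⟩)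
  have hstep : ∀ i, edist (γ (t i)) (γ (t (i + 1))) < δ := fun i => by
    obtain ⟨p, hp⟩ := ht i
    have hle : t i ≤ t (i + 1) := htmono i.le_succ
    calc edist (γ (t i)) (γ (t (i + 1))) ≤ edist (γ (t i)) (γ p) + edist (γ (t (i + 1))) (γ p) :=
          edist_triangle_right _ _ _
      _ < δ / 2 + δ / 2 := ENNReal.add_lt_add (hp (left_mem_Icc.2 hle)) (hp (right_mem_Icc.2 hle))
      _ = δ := ENNReal.add_halves δ
  calc edist (F (γ a)) (F (γ b)) = edist (F (γ (t 0))) (F (γ (t n))) := by rw [ht0, htn n le_rfl]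
    _ ≤ ∑ i ∈ Finset.range n, edist (F (γ (t i))) (F (γ (t (i + 1)))) :=
        edist_le_range_sum_edist (fun i => F (γ (t i))) n
    _ ≤ ∑ i ∈ Finset.range n, K * edist (γ (t (i + 1))) (γ (t i)) := by
        refine Finset.sum_le_sum fun i _ => ?_
        rw [edist_comm (γ (t (i + 1)))]
        exact hF _ (t i).2 _ (t (i + 1)).2 (hstep i)
    _ = K * ∑ i ∈ Finset.range n, edist (γ (t (i + 1))) (γ (t i)) := Finset.mul_sum .. |>.symm
    _ ≤ K * eVariationOn γ (Icc a b) := by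
        gcongr
        exact eVariationOn.sum_le (u := fun i => (t i : ℝ)) htmono fun i => (t i).2

theorem edist_le_mul_eVariationOn_of_ball_subset {X E : Type*} [PseudoMetricSpace X]
    [PseudoEMetricSpace E] {U : Set X} (hU : IsOpen U) {R : ℝ≥0∞} (hR : 0 < R) {C : ℝ≥0}
    {K : ℝ≥0∞} {F : X → E}
    (hF : ∀ x ∈ U, ∀ y ∈ U, C * edist x y ≤ R → ball x (C * dist x y) ⊆ U →
      edist (F x) (F y) ≤ K * edist x y)
    {a b : ℝ} (hab : a ≤ b) {γ : ℝ → X} (hγ : ContinuousOn γ (Icc a b))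
    (hγU : MapsTo γ (Icc a b) U) :
    edist (F (γ a)) (F (γ b)) ≤ K * eVariationOn γ (Icc a b) := by
  obtain ⟨ε, hε, hεU⟩ := (isCompact_Icc.image_of_continuousOn hγ).exists_thickening_subset_open hU
    hγU.image_subset
  have hδ : 0 < min R (ENNReal.ofReal ε) / (C + 1) :=
    ENNReal.div_pos (lt_min hR (ENNReal.ofReal_pos.2 hε)).ne' (by simp)
  refine edist_le_mul_eVariationOn hab hγ hδ fun s hs t ht hst => ?_
  have hsmall : C * edist (γ s) (γ t) ≤ min R (ENNReal.ofReal ε) :=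
    calc (C : ℝ≥0∞) * edist (γ s) (γ t)
        ≤ (C + 1) * (min R (ENNReal.ofReal ε) / (C + 1)) := mul_le_mul' le_self_add hst.le
      _ = min R (ENNReal.ofReal ε) := ENNReal.mul_div_cancel (by simp) (by simp)
  refine hF _ (hγU hs) _ (hγU ht) (hsmall.trans (min_le_left _ _))
    (Subset.trans (fun z hz => ?_) hεU)
  have hCε : (C : ℝ) * dist (γ s) (γ t) ≤ ε := by
    rw [← ENNReal.ofReal_le_ofReal_iff hε.le, ENNReal.ofReal_mul C.coe_nonneg,
      ENNReal.ofReal_coe_nnreal, ← edist_dist]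
    exact hsmall.trans (min_le_right _ _)
  exact mem_thickening_iff.2 ⟨γ s, mem_image_of_mem _ hs, (mem_ball.1 hz).trans_le hCε⟩

end Chaining

section TotalPerimeter

variable {X Y : Type*} [MetricSpace X] [MeasurableSpace X] [BorelSpace X] [MeasurableSpace Y]
  {μ : Measure X} {ν : Measure Y} [SFinite ν] {R : ℝ≥0∞} {β Λ τ : ℝ≥0} {U : Set X}
  {f : X → Lp ℝ 1 ν} {L : ℝ≥0} {k : ℕ}

theorem IsPIMeasure.doubleOsc_closedBall_le (h : IsPIMeasure μ R β Λ τ)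
    (hf : MemLp f 1 (μ.restrict U))
    (hL : ∀ (x : X) (r : ℝ), 0 < r → ball x r ⊆ U →
      totalPerimeter μ U (cutMeasure (μ.restrict U) ν f) (ball x r) ≤ L * μ (ball x r))
    (hΛk : Λ < 2 ^ k) {x : X} {s : ℝ} (hs : s ∈ admissibleScales R U (2 ^ (k + 1)) x) :
    doubleOsc μ (closedBall x s) f
      ≤ ↑(4 * (τ + 1) * β ^ (k + 2) * L) * ENNReal.ofReal s * μ (closedBall x s) ^ 2 := by
  obtain ⟨hs0, hsR, hsU⟩ := hs
  have hpow : (2 : ℝ) ^ k * (2 * s) = 2 ^ (k + 1) * s := by ring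
  have hs_le : ∀ j ≤ k + 1, ENNReal.ofReal (2 ^ j * s) ≤ R := fun j hj => by
    refine (ENNReal.ofReal_le_ofReal ?_).trans hsR
    gcongr
    norm_num
  have hosc := h.doubleOsc_le_totalPerimeter hf (x := x) (by positivity)
    (by simpa using hs_le 1 (by omega)) (isOpen_ball (x := x) (ε := 2 ^ (k + 1) * s))
    (ball_subset_ball (hpow ▸ le_mul_of_one_le_left (by positivity) (one_le_pow₀ one_le_two)))
    (closedBall_subset_ball (hpow ▸ mul_lt_mul_of_pos_right (by exact_mod_cast hΛk)
      (by positivity))) hsU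
  calc doubleOsc μ (closedBall x s) f
      ≤ doubleOsc μ (ball x (2 * s)) f := by
        have hsub : closedBall x s ⊆ ball x (2 * s) := closedBall_subset_ball (by linarith)
        exact (lintegral_mono_set hsub).trans (lintegral_mono fun z => lintegral_mono_set hsub)
    _ ≤ 2 * μ (ball x (2 * s)) * (ENNReal.ofReal (2 * s) * (τ + 1)) *
          totalPerimeter μ U (cutMeasure (μ.restrict U) ν f) (ball x (2 ^ (k + 1) * s)) := hosc
    _ ≤ 2 * (β * μ (closedBall x s)) * (ENNReal.ofReal (2 * s) * (τ + 1)) *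
          (L * (β ^ (k + 1) * μ (closedBall x s))) := by
        have hball : μ (ball x s) ≤ μ (closedBall x s) := measure_mono ball_subset_closedBall
        gcongr
        · exact (h.doubling x s hs0 (by simpa using hs_le 0 (by omega))).trans (by gcongr)
        · refine (hL x _ (by positivity) hsU).trans ?_
          gcongr
          exact (h.measure_ball_two_pow_mul_le x (k + 1) hs0 hsR).trans (by gcongr)
    _ = ↑(4 * (τ + 1) * β ^ (k + 2) * L) * ENNReal.ofReal s * μ (closedBall x s) ^ 2 := by
        rw [ENNReal.ofReal_mul zero_le_two, ENNReal.ofReal_ofNat]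
        push_cast
        ring

theorem IsPIMeasure.exists_lipschitz_of_totalPerimeter_le (h : IsPIMeasure μ R β Λ τ)
    (hR : 0 < R) (hU : IsOpen U) (hf : MemLp f 1 (μ.restrict U))
    (hL : ∀ (x : X) (r : ℝ), 0 < r → ball x r ⊆ U →
      totalPerimeter μ U (cutMeasure (μ.restrict U) ν f) (ball x r) ≤ L * μ (ball x r))
    (hk : 1 ≤ k) (hΛk : Λ < 2 ^ k) {C : ℝ≥0} (hkC : 4 * 2 ^ k ≤ C)
    (hβC : 32 * (τ + 1) * β ^ (k + 4) ≤ C) :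
    ∃ F : X → Lp ℝ 1 ν, F =ᵐ[μ.restrict U] f ∧
      ∀ x ∈ U, ∀ y ∈ U, C * edist x y ≤ R → ball x (C * dist x y) ⊆ U →
        edist (F x) (F y) ≤ C * L * edist x y := by
  have hN : (4 : ℝ) ≤ 2 ^ (k + 1) := by
    calc (4 : ℝ) = 2 ^ 2 := by norm_num
      _ ≤ 2 ^ (k + 1) := pow_le_pow_right₀ one_le_two (by omega)
  obtain ⟨F, hFf, hF⟩ := h.exists_lipschitz_representative hR hU (memLp_one_iff_integrable.1 hf) hN
    fun x s hs => h.doubleOsc_closedBall_le hf hL hΛk hs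
  refine ⟨F, hFf, fun x hx y hy hxyR hxyU => ?_⟩
  have hscale : 2 * 2 ^ (k + 1) * dist x y ≤ C * dist x y := by
    rw [pow_succ', show (2 : ℝ) * (2 * 2 ^ k) = 4 * 2 ^ k by ring]
    gcongr
    exact_mod_cast hkC
  have hradius : ENNReal.ofReal (C * dist x y) = C * edist x y := by
    rw [ENNReal.ofReal_mul C.coe_nonneg, ENNReal.ofReal_coe_nnreal, ← edist_dist]
  have hFxy := hF x hx y hy ((ENNReal.ofReal_le_ofReal hscale).trans (hradius ▸ hxyR))
    ((ball_subset_ball hscale).trans hxyU)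
  have hconst : 8 * (4 * (τ + 1) * β ^ (k + 2) * L * β ^ 2) ≤ C * L := by
    calc 8 * (4 * (τ + 1) * β ^ (k + 2) * L * β ^ 2) = 32 * (τ + 1) * β ^ (k + 4) * L := by ring
      _ ≤ C * L := by gcongr
  rw [← ENNReal.coe_mul, edist_nndist, edist_nndist]
  exact_mod_cast hFxy.trans (mul_le_mul_of_nonneg_right (by exact_mod_cast hconst) dist_nonneg)

end TotalPerimeter

section SliceRamp

/-- The signed height of the value `a` over the level `t`: up to a null set of levels, `a` belongs
to the slice at level `t` exactly when this is nonnegative. -/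
noncomputable def sliceHeight (t a : ℝ) : ℝ := if 0 < t then a - t else t - a

/-- A `K`-Lipschitz approximation of `sliceInd t`, used to approximate the characteristic functions
of the slices of a function by locally Lipschitz functions. -/
noncomputable def sliceRamp (K : ℝ≥0) (t a : ℝ) : ℝ := max 0 (min 1 (K * sliceHeight t a + 1))

theorem abs_sliceHeight (t a : ℝ) : |sliceHeight t a| = |a - t| := by
  unfold sliceHeight
  split_ifs
  exacts [rfl, abs_sub_comm t a]

theorem abs_sliceHeight_sub (t a b : ℝ) : |sliceHeight t a - sliceHeight t b| = |a - b| := by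
  unfold sliceHeight
  split_ifs
  · rw [sub_sub_sub_cancel_right]
  · rw [sub_sub_sub_cancel_left, abs_sub_comm]

theorem continuous_sliceHeight (t : ℝ) : Continuous (sliceHeight t) := by
  unfold sliceHeight
  split_ifs <;> fun_prop

theorem sliceInd_eq_ite_sliceHeight {t : ℝ} (ht : t ≠ 0) (a : ℝ) :
    sliceInd t a = if 0 ≤ sliceHeight t a then 1 else 0 := by
  rcases lt_or_gt_of_ne ht with h | h <;> simp [sliceInd, sliceHeight, h, h.not_gt]

theorem lipschitzWith_sliceRamp (K : ℝ≥0) (t : ℝ) : LipschitzWith K (sliceRamp K t) := by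
  have haffine : LipschitzWith K fun a => K * sliceHeight t a + 1 :=
    LipschitzWith.of_dist_le_mul fun a b => by
      rw [Real.dist_eq, Real.dist_eq, add_sub_add_right_eq_sub, ← mul_sub, abs_mul, NNReal.abs_eq,
        abs_sliceHeight_sub]
  exact (haffine.const_min 1).const_max 0

theorem measurable_sliceRamp (K : ℝ≥0) : Measurable fun p : ℝ × ℝ => sliceRamp K p.1 p.2 := by
  have hheight : Measurable fun p : ℝ × ℝ => sliceHeight p.1 p.2 :=
    Measurable.ite (measurableSet_lt measurable_const measurable_fst)
      (measurable_snd.sub measurable_fst) (measurable_fst.sub measurable_snd)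
  exact measurable_const.max (measurable_const.min ((hheight.const_mul _).add_const 1))

variable {K : ℝ≥0} {t a : ℝ}

theorem sliceRamp_eq_one (h : 0 ≤ sliceHeight t a) : sliceRamp K t a = 1 := by
  rw [sliceRamp, min_eq_left (le_add_of_nonneg_left (by positivity)), max_eq_right zero_le_one]

theorem sliceRamp_eq_zero (hK : 0 < K) (h : sliceHeight t a ≤ -(K : ℝ)⁻¹) :
    sliceRamp K t a = 0 := by
  have hle : K * sliceHeight t a + 1 ≤ 0 := by
    calc K * sliceHeight t a + 1 ≤ K * -(K : ℝ)⁻¹ + 1 := by gcongr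
      _ = 0 := by field_simp; ring
  exact max_eq_left ((min_le_right _ _).trans hle)

theorem eventually_sliceRamp_eq (hK : 0 < K) (h : (K : ℝ)⁻¹ < |a - t|) :
    ∀ᶠ a' in 𝓝 a, sliceRamp K t a' = sliceRamp K t a := by
  have hK' : (0 : ℝ) < (K : ℝ)⁻¹ := by positivity
  have hcont := (continuous_sliceHeight t).continuousAt (x := a)
  rcases lt_abs.1 (abs_sliceHeight t a ▸ h) with hpos | hneg
  · filter_upwards [hcont.eventually_const_lt hpos] with a' ha'
    rw [sliceRamp_eq_one (hK'.trans ha').le, sliceRamp_eq_one (hK'.trans hpos).le]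
  · filter_upwards [hcont.eventually_lt_const (lt_neg_of_lt_neg hneg)] with a' ha'
    rw [sliceRamp_eq_zero hK ha'.le, sliceRamp_eq_zero hK (by linarith)]

theorem enorm_sliceRamp_sub_sliceInd_le (hK : 0 < K) (ht : t ≠ 0) (a b : ℝ) :
    ‖sliceRamp K t a - sliceInd t b‖ₑ ≤ (closedBall b (|a - b| + (K : ℝ)⁻¹)).indicator 1 t := by
  rw [sliceInd_eq_ite_sliceHeight ht]
  by_cases h : t ∈ closedBall b (|a - b| + (K : ℝ)⁻¹)
  · rw [indicator_of_mem h, Pi.one_apply, Real.enorm_eq_ofReal_abs, ENNReal.ofReal_le_one]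
    have hnonneg : 0 ≤ sliceRamp K t a := le_max_left _ _
    have hle : sliceRamp K t a ≤ 1 := max_le zero_le_one (min_le_left _ _)
    split_ifs <;> rw [abs_le] <;> constructor <;> linarith
  · have hfar : |a - b| + (K : ℝ)⁻¹ < |sliceHeight t b| := by
      rw [abs_sliceHeight]
      rwa [mem_closedBall', Real.dist_eq, not_le] at h
    have hK' : (0 : ℝ) < (K : ℝ)⁻¹ := by positivity
    have hab := abs_le.1 (abs_sliceHeight_sub t a b).le
    split_ifs with hb
    · rw [abs_of_nonneg hb] at hfar
      simp [sliceRamp_eq_one (K := K) (by linarith : 0 ≤ sliceHeight t a)]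
    · rw [abs_of_neg (not_le.1 hb)] at hfar
      simp [sliceRamp_eq_zero hK (by linarith : sliceHeight t a ≤ -(K : ℝ)⁻¹)]

theorem lintegral_enorm_sliceRamp_sub_sliceInd_le (hK : 0 < K) (a b : ℝ) :
    ∫⁻ t, ‖sliceRamp K t a - sliceInd t b‖ₑ ≤ 2 * ‖a - b‖ₑ + 2 * (K : ℝ≥0∞)⁻¹ := by
  calc ∫⁻ t, ‖sliceRamp K t a - sliceInd t b‖ₑ
      ≤ ∫⁻ t, (closedBall b (|a - b| + (K : ℝ)⁻¹)).indicator 1 t := by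
        refine lintegral_mono_ae ?_
        filter_upwards [Measure.ae_ne volume 0] with t ht
        exact enorm_sliceRamp_sub_sliceInd_le hK ht a b
    _ = 2 * ‖a - b‖ₑ + 2 * (K : ℝ≥0∞)⁻¹ := by
        rw [lintegral_indicator_one measurableSet_closedBall, Real.volume_closedBall,
          Real.enorm_eq_ofReal_abs, ← mul_add, ENNReal.ofReal_mul zero_le_two,
          ENNReal.ofReal_add (abs_nonneg _) (by positivity),
          ENNReal.ofReal_inv_of_pos (by exact_mod_cast hK), ENNReal.ofReal_coe_nnreal,
          ENNReal.ofReal_ofNat]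

end SliceRamp

section Coarea

theorem locallyLipschitzOn_comp {X V W : Type*} [PseudoEMetricSpace X] [PseudoEMetricSpace V]
    [PseudoEMetricSpace W] {A : Set X} {v : X → V} {φ : V → W} {K : ℝ≥0}
    (hφ : LipschitzWith K φ) (hv : LocallyLipschitzOn A v) :
    LocallyLipschitzOn A fun x => φ (v x) := fun x hx => by
  obtain ⟨K', s, hs, hK'⟩ := hv hx
  exact ⟨K * K', s, hs, hφ.comp_lipschitzOnWith hK'⟩

theorem pointLip_sliceRamp_le {X : Type*} [PseudoMetricSpace X] {K : ℝ≥0} (hK : 0 < K)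
    {v : X → ℝ} {x : X} {D : ℝ≥0∞} (hv : ContinuousAt v x)
    (hD : ∀ᶠ x' in 𝓝 x, edist (v x) (v x') ≤ D * edist x x') (t : ℝ) :
    pointLip (fun z => sliceRamp K t (v z)) x
      ≤ K * (closedBall (v x) (K : ℝ)⁻¹).indicator 1 t * D := by
  by_cases h : t ∈ closedBall (v x) (K : ℝ)⁻¹
  · rw [indicator_of_mem h, Pi.one_apply, mul_one]
    refine pointLip_le ?_
    filter_upwards [hD] with x' hx'
    rw [mul_assoc]
    exact (lipschitzWith_sliceRamp K t _ _).trans (mul_le_mul_right hx' _)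
  · rw [indicator_of_notMem h, mul_zero, zero_mul]
    rw [mem_closedBall', Real.dist_eq, not_le] at h
    refine pointLip_le ?_
    filter_upwards [hv.eventually (eventually_sliceRamp_eq hK h)] with x' hx'
    simp [hx']

section Measurable

variable {α : Type*} [MeasurableSpace α] {v : α → ℝ}

theorem measurable_indicator_closedBall_comp (hv : Measurable v) (r : ℝ) :
    Measurable fun p : ℝ × α => (closedBall (v p.2) r).indicator (1 : ℝ → ℝ≥0∞) p.1 :=
  Measurable.ite (p := fun p : ℝ × α => p.1 ∈ closedBall (v p.2) r)
    (measurableSet_le (measurable_fst.dist (hv.comp measurable_snd)) measurable_const)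
    measurable_const measurable_const

theorem measurable_mul_indicator_closedBall_mul (hv : Measurable v) {D : α → ℝ≥0∞}
    (hD : Measurable D) (c : ℝ≥0∞) (r : ℝ) :
    Measurable fun p : ℝ × α => c * (closedBall (v p.2) r).indicator 1 p.1 * D p.2 :=
  ((measurable_indicator_closedBall_comp hv r).const_mul c).mul (hD.comp measurable_snd)

variable {μ : Measure α} {K : ℝ≥0}

theorem lintegral_lintegral_mul_indicator_closedBall_mul [SFinite μ] (hK : K ≠ 0)
    (hv : Measurable v) {D : α → ℝ≥0∞} (hD : Measurable D) :
    ∫⁻ t, ∫⁻ x, K * (closedBall (v x) (K : ℝ)⁻¹).indicator 1 t * D x ∂μ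
      = 2 * ∫⁻ x, D x ∂μ := by
  rw [lintegral_lintegral_swap (measurable_mul_indicator_closedBall_mul hv hD _ _).aemeasurable,
    ← lintegral_const_mul _ hD]
  refine lintegral_congr fun x => ?_
  have hind : Measurable fun t => (closedBall (v x) (K : ℝ)⁻¹).indicator (1 : ℝ → ℝ≥0∞) t :=
    measurable_one.indicator measurableSet_closedBall
  rw [lintegral_mul_const _ (hind.const_mul _), lintegral_const_mul _ hind,
    lintegral_indicator_one measurableSet_closedBall, Real.volume_closedBall,
    ENNReal.ofReal_mul zero_le_two,
    ENNReal.ofReal_inv_of_pos (NNReal.coe_pos.2 (pos_iff_ne_zero.2 hK)),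
    ENNReal.ofReal_coe_nnreal, mul_left_comm,
    ENNReal.mul_inv_cancel (by exact_mod_cast hK) ENNReal.coe_ne_top, mul_one, ENNReal.ofReal_ofNat]

theorem lintegral_lintegral_enorm_sliceRamp_sub_sliceInd_le [SFinite μ] (hK : 0 < K)
    {u : α → ℝ} (hv : Measurable v) (hu : Measurable u) :
    ∫⁻ t, ∫⁻ x, ‖sliceRamp K t (v x) - sliceInd t (u x)‖ₑ ∂μ
      ≤ 2 * ∫⁻ x, ‖v x - u x‖ₑ ∂μ + 2 * (K : ℝ≥0∞)⁻¹ * μ univ := by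
  have hmeas : Measurable fun p : ℝ × α => ‖sliceRamp K p.1 (v p.2) - sliceInd p.1 (u p.2)‖ₑ :=
    (((measurable_sliceRamp K).comp (measurable_fst.prodMk (hv.comp measurable_snd))).sub
      (measurable_sliceInd.comp (measurable_fst.prodMk (hu.comp measurable_snd)))).enorm
  rw [lintegral_lintegral_swap hmeas.aemeasurable]
  calc ∫⁻ x, ∫⁻ t, ‖sliceRamp K t (v x) - sliceInd t (u x)‖ₑ ∂volume ∂μ
      ≤ ∫⁻ x, (2 * ‖v x - u x‖ₑ + 2 * (K : ℝ≥0∞)⁻¹) ∂μ :=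
        lintegral_mono fun x => lintegral_enorm_sliceRamp_sub_sliceInd_le hK _ _
    _ = 2 * ∫⁻ x, ‖v x - u x‖ₑ ∂μ + 2 * (K : ℝ≥0∞)⁻¹ * μ univ := by
        have hvu : Measurable fun x => ‖v x - u x‖ₑ := (hv.sub hu).enorm
        rw [lintegral_add_right _ measurable_const, lintegral_const_mul _ hvu, lintegral_const]

theorem ae_tendsto_lintegral_sliceRamp_sub_sliceInd [IsFiniteMeasure μ] {u : α → ℝ}
    (hu : Measurable u) {v : ℕ → α → ℝ} (hv : ∀ n, Measurable (v n))
    (hsum : ∑' n, ∫⁻ x, ‖v n x - u x‖ₑ ∂μ ≠ ∞) :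
    ∀ᵐ t, Tendsto (fun n => ∫⁻ x, ‖sliceRamp (2 ^ n) t (v n x) - sliceInd t (u x)‖ₑ ∂μ)
      atTop (𝓝 0) := by
  have hmeas : ∀ n, Measurable fun t : ℝ =>
      ∫⁻ x, ‖sliceRamp (2 ^ n) t (v n x) - sliceInd t (u x)‖ₑ ∂μ := fun n =>
    (((measurable_sliceRamp (2 ^ n)).comp (measurable_fst.prodMk ((hv n).comp measurable_snd))).sub
      (measurable_sliceInd.comp
        (measurable_fst.prodMk (hu.comp measurable_snd)))).enorm.lintegral_prod_right'
  have hfin : ∫⁻ t, ∑' n, ∫⁻ x, ‖sliceRamp (2 ^ n) t (v n x) - sliceInd t (u x)‖ₑ ∂μ ≠ ∞ := by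
    rw [lintegral_tsum fun n => (hmeas n).aemeasurable]
    refine ne_top_of_le_ne_top ?_ (ENNReal.tsum_le_tsum fun n =>
      lintegral_lintegral_enorm_sliceRamp_sub_sliceInd_le (by positivity) (hv n) hu)
    have hgeom : ∑' n : ℕ, (((2 ^ n : ℝ≥0) : ℝ≥0∞))⁻¹ ≠ ∞ := by
      simp only [ENNReal.coe_pow, ENNReal.coe_ofNat, ENNReal.inv_pow]
      rw [ENNReal.tsum_geometric_two]
      exact ENNReal.ofNat_ne_top
    rw [ENNReal.tsum_add, ENNReal.tsum_mul_left, ENNReal.tsum_mul_right, ENNReal.tsum_mul_left]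
    finiteness
  filter_upwards [ae_lt_top (Measurable.tsum hmeas) hfin] with t ht
  exact ENNReal.tendsto_atTop_zero_of_tsum_ne_top ht.ne

end Measurable

variable {X : Type*} [MetricSpace X] [MeasurableSpace X] {μ : Measure X} {A : Set X}
  {u : X → ℝ} {v : ℕ → X → ℝ} {D : ℕ → X → ℝ≥0∞}

theorem variation_sliceInd_le_liminf [OpensMeasurableSpace X] (hA : IsOpen A)
    (hv : ∀ n, LocallyLipschitzOn A (v n))
    (hD : ∀ n, ∀ x ∈ A, ∀ᶠ x' in 𝓝 x, edist (v n x) (v n x') ≤ D n x * edist x x')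
    {K : ℕ → ℝ≥0} (hK : ∀ n, 0 < K n) {t : ℝ}
    (ht : Tendsto (fun n => ∫⁻ x in A, ‖sliceRamp (K n) t (v n x) - sliceInd t (u x)‖ₑ ∂μ)
      atTop (𝓝 0)) :
    variation μ (fun x => sliceInd t (u x)) A ≤ liminf (fun n => ∫⁻ x in A,
      K n * (closedBall (v n x) (K n : ℝ)⁻¹).indicator 1 t * D n x ∂μ) atTop := by
  refine (variation_le (hs := fun n x => sliceRamp (K n) t (v n x))
    (fun n => locallyLipschitzOn_comp (lipschitzWith_sliceRamp (K n) t) (hv n)) ?_).trans ?_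
  · simpa only [eLpNorm_one_eq_lintegral_enorm, Pi.sub_apply] using ht
  · refine liminf_le_liminf (Eventually.of_forall fun n => ?_)
    refine setLIntegral_mono' hA.measurableSet fun x hx => ?_
    exact pointLip_sliceRamp_le (hK n) ((hv n).continuousOn.continuousAt (hA.mem_nhds hx))
      (hD n x hx) t

theorem lintegral_variation_sliceInd_le [OpensMeasurableSpace X] [SFinite μ] (hA : IsOpen A)
    (hμA : μ A ≠ ∞) (hu : Measurable u) (hvm : ∀ n, Measurable (v n))
    (hv : ∀ n, LocallyLipschitzOn A (v n)) (hDm : ∀ n, Measurable (D n))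
    (hD : ∀ n, ∀ x ∈ A, ∀ᶠ x' in 𝓝 x, edist (v n x) (v n x') ≤ D n x * edist x x')
    (hsum : ∑' n, ∫⁻ x in A, ‖v n x - u x‖ₑ ∂μ ≠ ∞) :
    ∫⁻ t, variation μ (fun x => sliceInd t (u x)) A
      ≤ 2 * liminf (fun n => ∫⁻ x in A, D n x ∂μ) atTop := by
  have : IsFiniteMeasure (μ.restrict A) := isFiniteMeasure_restrict.2 hμA
  let J (n : ℕ) (t : ℝ) : ℝ≥0∞ := ∫⁻ x in A,
    (2 ^ n : ℝ≥0) * (closedBall (v n x) ((2 ^ n : ℝ≥0) : ℝ)⁻¹).indicator 1 t * D n x ∂μ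
  calc ∫⁻ t, variation μ (fun x => sliceInd t (u x)) A
      ≤ ∫⁻ t, liminf (fun n => J n t) atTop := by
        refine lintegral_mono_ae ?_
        filter_upwards [ae_tendsto_lintegral_sliceRamp_sub_sliceInd hu hvm hsum] with t ht
        exact variation_sliceInd_le_liminf hA hv hD (fun n => by positivity) ht
    _ ≤ liminf (fun n => ∫⁻ t, J n t) atTop := lintegral_liminf_le fun n =>
        (measurable_mul_indicator_closedBall_mul (hvm n) (hDm n) _ _).lintegral_prod_right'
    _ = liminf (fun n => 2 * ∫⁻ x in A, D n x ∂μ) atTop := by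
        simp only [J, lintegral_lintegral_mul_indicator_closedBall_mul (pow_ne_zero _ two_ne_zero)
          (hvm _) (hDm _)]
    _ = 2 * liminf (fun n => ∫⁻ x in A, D n x ∂μ) atTop :=
        ENNReal.liminf_const_mul_of_ne_top ENNReal.ofNat_ne_top

end Coarea

theorem enorm_div_of_ne_zero {a b : ℝ} (hb : b ≠ 0) : ‖a / b‖ₑ = ‖a‖ₑ / ‖b‖ₑ := by
  rw [div_eq_mul_inv, enorm_mul, enorm_inv hb, div_eq_mul_inv]

theorem inv_le_two_mul_inv {a b : ℝ≥0∞} (h : a ≤ 2 * b) : b⁻¹ ≤ 2 * a⁻¹ := by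
  calc b⁻¹ = 2 * (2 * b)⁻¹ := by
        rw [ENNReal.mul_inv (.inl two_ne_zero) (.inl ENNReal.ofNat_ne_top), ← mul_assoc,
          ENNReal.mul_inv_cancel two_ne_zero ENNReal.ofNat_ne_top, one_mul]
    _ ≤ 2 * a⁻¹ := by gcongr

section WeightedAverage

variable {α : Type*} [MeasurableSpace α] {μ : Measure α} {B : Set α} {φ ψ h : α → ℝ} {C ε : ℝ≥0}

/-- The average of `h` with respect to the weight `φ`. -/
noncomputable def weightedAvg (μ : Measure α) (φ h : α → ℝ) : ℝ :=
  (∫ w, φ w * h w ∂μ) / ∫ w, φ w ∂μ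

theorem integrable_of_enorm_le_indicator (hB : MeasurableSet B) (hμB : μ B ≠ ∞)
    (hφm : AEStronglyMeasurable φ μ) (hφ : ∀ w, ‖φ w‖ₑ ≤ B.indicator (fun _ => ↑C) w) :
    Integrable φ μ :=
  ⟨hφm, (lintegral_mono hφ).trans_lt (by rw [lintegral_indicator_const hB]; finiteness)⟩

theorem integrable_mul_of_enorm_le_indicator (hφm : AEStronglyMeasurable φ μ)
    (hφ : ∀ w, ‖φ w‖ₑ ≤ B.indicator (fun _ => ↑C) w) (hh : Integrable h μ) :
    Integrable (fun w => φ w * h w) μ :=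
  hh.bdd_mul (c := C) hφm (Eventually.of_forall fun w => by
    exact_mod_cast (hφ w).trans (indicator_le_self _ _ w))

theorem enorm_integral_mul_le (hB : MeasurableSet B)
    (hφ : ∀ w, ‖φ w‖ₑ ≤ B.indicator (fun _ => ↑C) w) (g : α → ℝ) :
    ‖∫ w, φ w * g w ∂μ‖ₑ ≤ C * ∫⁻ w in B, ‖g w‖ₑ ∂μ := by
  calc ‖∫ w, φ w * g w ∂μ‖ₑ ≤ ∫⁻ w, ‖φ w * g w‖ₑ ∂μ := enorm_integral_le_lintegral_enorm _
    _ ≤ ∫⁻ w, B.indicator (fun w => C * ‖g w‖ₑ) w ∂μ := by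
        refine lintegral_mono fun w => ?_
        rw [enorm_mul, indicator_mul_left]
        exact mul_le_mul_left (hφ w) _
    _ = C * ∫⁻ w in B, ‖g w‖ₑ ∂μ := by
        rw [lintegral_indicator hB, lintegral_const_mul' _ _ ENNReal.coe_ne_top]

theorem weightedAvg_sub_const (hφi : Integrable φ μ) (hφh : Integrable (fun w => φ w * h w) μ)
    (hφ0 : ∫ w, φ w ∂μ ≠ 0) (c : ℝ) :
    weightedAvg μ φ h - c = (∫ w, φ w * (h w - c) ∂μ) / ∫ w, φ w ∂μ := by
  have hsub : ∫ w, φ w * (h w - c) ∂μ = ∫ w, φ w * h w ∂μ - (∫ w, φ w ∂μ) * c := by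
    simp only [mul_sub]
    rw [integral_sub hφh (hφi.mul_const c), integral_mul_const]
  rw [hsub, weightedAvg, sub_div, mul_div_cancel_left₀ _ hφ0]

theorem enorm_weightedAvg_sub_le (hB : MeasurableSet B)
    (hφ : ∀ w, ‖φ w‖ₑ ≤ B.indicator (fun _ => ↑C) w) (hφi : Integrable φ μ)
    (hφh : Integrable (fun w => φ w * h w) μ) (hφ0 : ∫ w, φ w ∂μ ≠ 0) (c : ℝ) :
    ‖weightedAvg μ φ h - c‖ₑ ≤ C * ((∫⁻ w in B, ‖h w - c‖ₑ ∂μ) / ‖∫ w, φ w ∂μ‖ₑ) := by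
  rw [weightedAvg_sub_const hφi hφh hφ0, enorm_div_of_ne_zero hφ0, ← mul_div_assoc]
  gcongr
  exact enorm_integral_mul_le hB hφ _

theorem lintegral_enorm_sub_weightedAvg_le (hB : MeasurableSet B)
    (hφ : ∀ w, ‖φ w‖ₑ ≤ B.indicator (fun _ => ↑C) w) (hφi : Integrable φ μ)
    (hφh : Integrable (fun w => φ w * h w) μ) (hφ0 : ∫ w, φ w ∂μ ≠ 0) (c : ℝ) :
    ∫⁻ w in B, ‖h w - weightedAvg μ φ h‖ₑ ∂μ
      ≤ (C * μ B / ‖∫ w, φ w ∂μ‖ₑ + 1) * ∫⁻ w in B, ‖h w - c‖ₑ ∂μ := by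
  calc ∫⁻ w in B, ‖h w - weightedAvg μ φ h‖ₑ ∂μ
      ≤ ∫⁻ w in B, (‖weightedAvg μ φ h - c‖ₑ + ‖h w - c‖ₑ) ∂μ := by
        refine lintegral_mono fun w => ?_
        rw [add_comm, ← sub_sub_sub_cancel_right _ _ c]
        exact enorm_sub_le
    _ = ‖weightedAvg μ φ h - c‖ₑ * μ B + ∫⁻ w in B, ‖h w - c‖ₑ ∂μ := by
        rw [lintegral_add_left measurable_const, setLIntegral_const]
    _ ≤ C * ((∫⁻ w in B, ‖h w - c‖ₑ ∂μ) / ‖∫ w, φ w ∂μ‖ₑ) * μ B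
          + ∫⁻ w in B, ‖h w - c‖ₑ ∂μ := by
        gcongr
        exact enorm_weightedAvg_sub_le hB hφ hφi hφh hφ0 c
    _ = (C * μ B / ‖∫ w, φ w ∂μ‖ₑ + 1) * ∫⁻ w in B, ‖h w - c‖ₑ ∂μ := by
        simp only [div_eq_mul_inv]
        ring

theorem enorm_weightedAvg_sub_weightedAvg_le (hB : MeasurableSet B)
    (hψφ : ∀ w, ‖ψ w - φ w‖ₑ ≤ B.indicator (fun _ => ↑ε) w)
    (hφi : Integrable φ μ) (hφh : Integrable (fun w => φ w * h w) μ) (hφ0 : ∫ w, φ w ∂μ ≠ 0)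
    (hψi : Integrable ψ μ) (hψh : Integrable (fun w => ψ w * h w) μ) (hψ0 : ∫ w, ψ w ∂μ ≠ 0) :
    ‖weightedAvg μ φ h - weightedAvg μ ψ h‖ₑ
      ≤ ε * ((∫⁻ w in B, ‖h w - weightedAvg μ φ h‖ₑ ∂μ) / ‖∫ w, ψ w ∂μ‖ₑ) := by
  set e := weightedAvg μ φ h
  have hφe : ∫ w, φ w * (h w - e) ∂μ = 0 := by
    have hsub := weightedAvg_sub_const hφi hφh hφ0 e
    rwa [sub_self, eq_comm, div_eq_zero_iff, or_iff_left hφ0] at hsub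
  have hint : ∀ {χ : α → ℝ}, Integrable χ μ → Integrable (fun w => χ w * h w) μ →
      Integrable (fun w => χ w * (h w - e)) μ := fun hχ hχh => by
    simp only [mul_sub]
    exact hχh.sub (hχ.mul_const e)
  have hψe : ∫ w, ψ w * (h w - e) ∂μ = ∫ w, (ψ w - φ w) * (h w - e) ∂μ := by
    simp only [sub_mul]
    rw [integral_sub (hint hψi hψh) (hint hφi hφh), hφe, sub_zero]
  rw [enorm_sub_rev, weightedAvg_sub_const hψi hψh hψ0, hψe, enorm_div_of_ne_zero hψ0,
    ← mul_div_assoc]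
  gcongr
  exact enorm_integral_mul_le hB hψφ _

end WeightedAverage

section Smoothing

variable {X : Type*} [MetricSpace X] {δ : X → ℝ} {z z' : X}

/-- The tent function at the scale `δ z` around `z`. -/
noncomputable def tent (δ : X → ℝ) (z w : X) : ℝ := max 0 (δ z - dist z w)

theorem tent_nonneg (z w : X) : 0 ≤ tent δ z w := le_max_left _ _

theorem tent_eq_zero {w : X} (h : δ z ≤ dist z w) : tent δ z w = 0 :=
  max_eq_left (sub_nonpos.2 h)

theorem continuous_tent (hδ : Continuous δ) : Continuous fun p : X × X => tent δ p.1 p.2 :=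
  continuous_const.max ((hδ.comp continuous_fst).sub (continuous_fst.dist continuous_snd))

theorem enorm_tent_le (z w : X) :
    ‖tent δ z w‖ₑ ≤ (ball z (2 * δ z)).indicator (fun _ => ((δ z).toNNReal : ℝ≥0∞)) w := by
  by_cases hw : w ∈ ball z (2 * δ z)
  · rw [indicator_of_mem hw, Real.enorm_of_nonneg (tent_nonneg z w)]
    have hz : 0 < δ z := by linarith [pos_of_mem_ball hw]
    exact ENNReal.ofReal_le_ofReal (max_le hz.le (sub_le_self _ dist_nonneg))
  · rw [mem_ball, dist_comm, not_lt] at hw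
    have hz : δ z ≤ dist z w := by linarith [dist_nonneg (x := z) (y := w)]
    simp [tent_eq_zero hz]

theorem enorm_tent_sub_le (hδ : LipschitzWith 1 δ) (hz : 2 * dist z z' ≤ δ z) (w : X) :
    ‖tent δ z' w - tent δ z w‖ₑ
      ≤ (ball z (2 * δ z)).indicator (fun _ => ((2 * nndist z z' : ℝ≥0) : ℝ≥0∞)) w := by
  have hδz := abs_le.1 (hδ.dist_le_mul z z')
  have htri := abs_le.1 (abs_dist_sub_le z z' w)
  rw [NNReal.coe_one, one_mul] at hδz
  by_cases hw : w ∈ ball z (2 * δ z)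
  · rw [indicator_of_mem hw, ← enorm_norm, Real.enorm_of_nonneg (norm_nonneg _)]
    refine ENNReal.ofReal_le_of_le_toReal ?_
    refine (abs_max_sub_max_le_max _ _ _ _).trans ?_
    rw [sub_self, abs_zero, max_eq_right (abs_nonneg _), abs_le]
    rw [ENNReal.coe_toReal, NNReal.coe_mul, coe_nndist, NNReal.coe_ofNat]
    constructor <;> linarith
  · rw [mem_ball, dist_comm, not_lt] at hw
    rw [tent_eq_zero (by linarith), tent_eq_zero (by linarith [dist_nonneg (x := z) (y := z')])]
    simp

variable [MeasurableSpace X] {μ : Measure X}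

/-- The averages of `h` against the tent functions at the variable scale `δ`. -/
noncomputable def smoothing (μ : Measure X) (δ h : X → ℝ) (z : X) : ℝ := weightedAvg μ (tent δ z) h

/-- The `L¹` oscillation of `h` around `z` at the scale of the tent function, normalized by the
mass of the tent function. -/
noncomputable def tentOsc (μ : Measure X) (δ h : X → ℝ) (z : X) : ℝ≥0∞ :=
  (∫⁻ w in ball z (2 * δ z), ‖h w - h z‖ₑ ∂μ) / ‖∫ w, tent δ z w ∂μ‖ₑ

variable {R : ℝ≥0∞} {β Λ τ : ℝ≥0} {h : X → ℝ}

theorem IsPIMeasure.one_le (hμ : IsPIMeasure μ R β Λ τ) (z : X) {r : ℝ} (hr : 0 < r)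
    (hrR : ENNReal.ofReal r ≤ R) : 1 ≤ β := by
  have hball : 1 * μ (ball z r) ≤ β * μ (ball z r) :=
    (one_mul (μ (ball z r))).trans_le
      ((measure_mono (ball_subset_ball (by linarith))).trans (hμ.doubling z r hr hrR))
  exact_mod_cast (ENNReal.mul_le_mul_iff_left (hμ.ball_pos z r hr).ne'
    (hμ.ball_lt_top z r).ne).1 hball

theorem IsPIMeasure.two_mul_dist_le (hμ : IsPIMeasure μ R β Λ τ) (hz : 0 < δ z)
    (hzR : ENNReal.ofReal (2 * δ z) ≤ R) (hzz : 8 * β ^ 2 * dist z z' ≤ δ z) :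
    2 * dist z z' ≤ δ z := by
  have hβ : (1 : ℝ) ≤ β ^ 2 := one_le_pow₀ (by exact_mod_cast hμ.one_le z (by positivity) hzR)
  nlinarith [dist_nonneg (x := z) (y := z')]

variable [BorelSpace X]

theorem aestronglyMeasurable_tent (hδ : Continuous δ) (z : X) :
    AEStronglyMeasurable (tent δ z) μ :=
  ((continuous_tent hδ).comp (Continuous.prodMk_right z)).aestronglyMeasurable

theorem IsPIMeasure.integrable_tent (hμ : IsPIMeasure μ R β Λ τ) (hδ : Continuous δ) (z : X) :
    Integrable (tent δ z) μ :=
  integrable_of_enorm_le_indicator measurableSet_ball (hμ.ball_lt_top _ _).ne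
    (aestronglyMeasurable_tent hδ z) (enorm_tent_le z)

theorem integrable_tent_mul (hδ : Continuous δ) (hh : Integrable h μ) (z : X) :
    Integrable (fun w => tent δ z w * h w) μ :=
  integrable_mul_of_enorm_le_indicator (aestronglyMeasurable_tent hδ z) (enorm_tent_le z) hh

theorem IsPIMeasure.mul_measure_ball_le_enorm_integral_tent (hμ : IsPIMeasure μ R β Λ τ)
    (hδ : Continuous δ) (hz : 0 < δ z) (hzR : ENNReal.ofReal (2 * δ z) ≤ R) :
    ENNReal.ofReal (δ z) * μ (ball z (2 * δ z)) ≤ 2 * β ^ 2 * ‖∫ w, tent δ z w ∂μ‖ₑ := by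
  have hball : μ (ball z (2 * δ z)) ≤ β ^ 2 * μ (ball z (δ z / 2)) := by
    convert hμ.measure_ball_two_pow_mul_le z 2 (half_pos hz) (by convert hzR using 2; ring) using 3
    ring
  have hmass : ENNReal.ofReal (δ z / 2) * μ (ball z (δ z / 2)) ≤ ‖∫ w, tent δ z w ∂μ‖ₑ := by
    rw [Real.enorm_of_nonneg (integral_nonneg (tent_nonneg z)), ofReal_integral_eq_lintegral_ofReal
      (hμ.integrable_tent hδ z) (Eventually.of_forall (tent_nonneg z)), ← setLIntegral_const]
    refine (setLIntegral_mono' measurableSet_ball fun w hw => ?_).trans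
      (setLIntegral_le_lintegral (ball z (δ z / 2)) _)
    rw [mem_ball, dist_comm] at hw
    exact ENNReal.ofReal_le_ofReal (le_max_of_le_right (by linarith))
  calc ENNReal.ofReal (δ z) * μ (ball z (2 * δ z))
      = 2 * (ENNReal.ofReal (δ z / 2) * μ (ball z (2 * δ z))) := by
        rw [← mul_assoc, ← ENNReal.ofReal_ofNat, ← ENNReal.ofReal_mul zero_le_two,
          mul_div_cancel₀ _ two_ne_zero]
    _ ≤ 2 * (ENNReal.ofReal (δ z / 2) * (β ^ 2 * μ (ball z (δ z / 2)))) := by gcongr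
    _ = 2 * β ^ 2 * (ENNReal.ofReal (δ z / 2) * μ (ball z (δ z / 2))) := by ring
    _ ≤ 2 * β ^ 2 * ‖∫ w, tent δ z w ∂μ‖ₑ := by gcongr

theorem IsPIMeasure.integral_tent_ne_zero (hμ : IsPIMeasure μ R β Λ τ) (hδ : Continuous δ)
    (hz : 0 < δ z) (hzR : ENNReal.ofReal (2 * δ z) ≤ R) : ∫ w, tent δ z w ∂μ ≠ 0 := by
  intro h0
  have hmass := hμ.mul_measure_ball_le_enorm_integral_tent hδ hz hzR
  rw [h0, enorm_zero, mul_zero, nonpos_iff_eq_zero] at hmass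
  exact mul_ne_zero (ENNReal.ofReal_pos.2 hz).ne' (hμ.ball_pos z _ (by positivity)).ne' hmass

theorem IsPIMeasure.enorm_integral_tent_le (hμ : IsPIMeasure μ R β Λ τ) (hδ : LipschitzWith 1 δ)
    (hz : 0 < δ z) (hzR : ENNReal.ofReal (2 * δ z) ≤ R) (hzz : 8 * β ^ 2 * dist z z' ≤ δ z) :
    ‖∫ w, tent δ z w ∂μ‖ₑ ≤ 2 * ‖∫ w, tent δ z' w ∂μ‖ₑ := by
  set m := ∫ w, tent δ z w ∂μ
  set m' := ∫ w, tent δ z' w ∂μ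
  have hβ : (2 * β ^ 2 : ℝ≥0∞) ≠ 0 :=
    mul_ne_zero two_ne_zero (pow_ne_zero 2
      (by exact_mod_cast (one_pos.trans_le (hμ.one_le z (by positivity) hzR)).ne'))
  have hdiff : ‖m' - m‖ₑ ≤ 2 * edist z z' * μ (ball z (2 * δ z)) := by
    have hsub := enorm_integral_mul_le (μ := μ) measurableSet_ball
      (enorm_tent_sub_le hδ (hμ.two_mul_dist_le hz hzR hzz)) fun _ => (1 : ℝ)
    simp only [mul_one, enorm_one, setLIntegral_const, one_mul] at hsub
    rw [integral_sub (hμ.integrable_tent hδ.continuous z') (hμ.integrable_tent hδ.continuous z)]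
      at hsub
    simpa only [edist_nndist, ENNReal.coe_mul, ENNReal.coe_ofNat] using hsub
  have hhalf : 2 * ‖m' - m‖ₑ ≤ ‖m‖ₑ := by
    rw [← ENNReal.mul_le_mul_iff_right hβ (by finiteness)]
    calc 2 * β ^ 2 * (2 * ‖m' - m‖ₑ)
        ≤ 2 * β ^ 2 * (2 * (2 * edist z z' * μ (ball z (2 * δ z)))) := by gcongr
      _ = ENNReal.ofReal (8 * β ^ 2 * dist z z') * μ (ball z (2 * δ z)) := by
          rw [ENNReal.ofReal_mul (by positivity), ENNReal.ofReal_mul (by positivity),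
            ENNReal.ofReal_pow (by positivity), ENNReal.ofReal_coe_nnreal, ENNReal.ofReal_ofNat,
            ← edist_dist]
          ring
      _ ≤ ENNReal.ofReal (δ z) * μ (ball z (2 * δ z)) := by gcongr
      _ ≤ 2 * β ^ 2 * ‖m‖ₑ := hμ.mul_measure_ball_le_enorm_integral_tent hδ.continuous hz hzR
  have htri : ‖m‖ₑ ≤ ‖m'‖ₑ + ‖m' - m‖ₑ := by simpa using enorm_sub_le (a := m') (b := m' - m)
  refine ENNReal.le_of_add_le_add_right (a := ‖m‖ₑ) enorm_ne_top ?_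
  calc ‖m‖ₑ + ‖m‖ₑ = 2 * ‖m‖ₑ := (two_mul _).symm
    _ ≤ 2 * (‖m'‖ₑ + ‖m' - m‖ₑ) := by gcongr
    _ = 2 * ‖m'‖ₑ + 2 * ‖m' - m‖ₑ := mul_add _ _ _
    _ ≤ 2 * ‖m'‖ₑ + ‖m‖ₑ := by gcongr

theorem IsPIMeasure.enorm_smoothing_sub_le (hμ : IsPIMeasure μ R β Λ τ) (hδ : Continuous δ)
    (hz : 0 < δ z) (hzR : ENNReal.ofReal (2 * δ z) ≤ R) (hh : Integrable h μ) :
    ‖smoothing μ δ h z - h z‖ₑ ≤ ENNReal.ofReal (δ z) * tentOsc μ δ h z :=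
  enorm_weightedAvg_sub_le measurableSet_ball (enorm_tent_le z) (hμ.integrable_tent hδ z)
    (integrable_tent_mul hδ hh z) (hμ.integral_tent_ne_zero hδ hz hzR) _

theorem IsPIMeasure.edist_smoothing_le (hμ : IsPIMeasure μ R β Λ τ) (hδ : LipschitzWith 1 δ)
    (hz : 0 < δ z) (hzR : ENNReal.ofReal (2 * δ z) ≤ R) (hzz : 8 * β ^ 2 * dist z z' ≤ δ z)
    (hh : Integrable h μ) (c : ℝ) :
    edist (smoothing μ δ h z) (smoothing μ δ h z') ≤ 4 * (2 * β ^ 2 + 1) *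
      ((∫⁻ w in ball z (2 * δ z), ‖h w - c‖ₑ ∂μ) / ‖∫ w, tent δ z w ∂μ‖ₑ) * edist z z' := by
  have hδc := hδ.continuous
  have hm := hμ.integral_tent_ne_zero hδc hz hzR
  have hmm' := hμ.enorm_integral_tent_le hδ hz hzR hzz
  have hm' : ∫ w, tent δ z' w ∂μ ≠ 0 := fun h0 => hm (by simpa [h0] using hmm')
  set m := ∫ w, tent δ z w ∂μ
  set m' := ∫ w, tent δ z' w ∂μ
  set I := ∫⁻ w in ball z (2 * δ z), ‖h w - c‖ₑ ∂μ
  have hosc : ∫⁻ w in ball z (2 * δ z), ‖h w - smoothing μ δ h z‖ₑ ∂μ ≤ (2 * β ^ 2 + 1) * I := by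
    refine (lintegral_enorm_sub_weightedAvg_le measurableSet_ball (enorm_tent_le z)
      (hμ.integrable_tent hδc z) (integrable_tent_mul hδc hh z) hm c).trans ?_
    gcongr
    exact ENNReal.div_le_of_le_mul (hμ.mul_measure_ball_le_enorm_integral_tent hδc hz hzR)
  rw [edist_eq_enorm_sub]
  calc ‖smoothing μ δ h z - smoothing μ δ h z'‖ₑ
      ≤ (2 * nndist z z' : ℝ≥0) *
          ((∫⁻ w in ball z (2 * δ z), ‖h w - smoothing μ δ h z‖ₑ ∂μ) / ‖m'‖ₑ) :=
        enorm_weightedAvg_sub_weightedAvg_le measurableSet_ball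
          (enorm_tent_sub_le hδ (hμ.two_mul_dist_le hz hzR hzz)) (hμ.integrable_tent hδc z)
          (integrable_tent_mul hδc hh z) hm (hμ.integrable_tent hδc z')
          (integrable_tent_mul hδc hh z') hm'
    _ ≤ (2 * nndist z z' : ℝ≥0) * ((2 * β ^ 2 + 1) * I * (2 * ‖m‖ₑ⁻¹)) := by
        rw [div_eq_mul_inv]
        gcongr
        exact inv_le_two_mul_inv hmm'
    _ = 4 * (2 * β ^ 2 + 1) * (I / ‖m‖ₑ) * edist z z' := by
        rw [edist_nndist, div_eq_mul_inv]
        push_cast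
        ring

theorem IsPIMeasure.eventually_edist_smoothing_le (hμ : IsPIMeasure μ R β Λ τ)
    (hδ : LipschitzWith 1 δ) (hz : 0 < δ z) (hzR : ENNReal.ofReal (2 * δ z) ≤ R)
    (hh : Integrable h μ) :
    ∀ᶠ z' in 𝓝 z, edist (smoothing μ δ h z) (smoothing μ δ h z')
      ≤ 4 * (2 * β ^ 2 + 1) * tentOsc μ δ h z * edist z z' := by
  have hclose : ∀ᶠ z' in 𝓝 z, 8 * β ^ 2 * dist z z' < δ z := by
    refine ContinuousAt.eventually_lt (by fun_prop) continuousAt_const ?_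
    simpa using hz
  filter_upwards [hclose] with z' hz'
  exact hμ.edist_smoothing_le hδ hz hzR hz'.le hh (h z)

theorem IsPIMeasure.locallyLipschitzOn_smoothing (hμ : IsPIMeasure μ R β Λ τ)
    (hδ : LipschitzWith 1 δ) {A : Set X} (hA : ∀ z ∈ A, 0 < δ z)
    (hR : ∀ z, ENNReal.ofReal (2 * δ z) ≤ R) (hh : Integrable h μ) :
    LocallyLipschitzOn A (smoothing μ δ h) := by
  intro z₀ hz₀
  have hd₀ := hA z₀ hz₀
  have hm₀ := hμ.integral_tent_ne_zero hδ.continuous hd₀ (hR z₀)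
  have hβ : (1 : ℝ) ≤ β ^ 2 :=
    one_le_pow₀ (by exact_mod_cast hμ.one_le z₀ (by positivity) (hR z₀))
  set m₀ := ∫ w, tent δ z₀ w ∂μ
  set K : ℝ≥0∞ := 4 * (2 * β ^ 2 + 1) * ((∫⁻ w, ‖h w‖ₑ ∂μ) * (2 * ‖m₀‖ₑ⁻¹))
  have hK : K ≠ ∞ := by
    have hinv : ‖m₀‖ₑ⁻¹ ≠ ∞ := by simpa using hm₀
    have hint : ∫⁻ w, ‖h w‖ₑ ∂μ ≠ ∞ := hh.2.ne
    finiteness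
  have hnear : ∀ z ∈ ball z₀ (δ z₀ / (32 * β ^ 2)), 32 * β ^ 2 * dist z₀ z ≤ δ z₀ := by
    intro z hz
    rw [mem_ball', lt_div_iff₀' (by positivity)] at hz
    exact hz.le
  refine ⟨K.toNNReal, ball z₀ (δ z₀ / (32 * β ^ 2)),
    mem_nhdsWithin_of_mem_nhds (ball_mem_nhds z₀ (by positivity)), ?_⟩
  intro z hz z' hz'
  have hdz : δ z₀ / 2 ≤ δ z := by
    have hδz := (abs_le.1 (hδ.dist_le_mul z₀ z)).2
    rw [NNReal.coe_one, one_mul] at hδz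
    nlinarith [hnear z hz, dist_nonneg (x := z₀) (y := z)]
  have hzz : 8 * β ^ 2 * dist z z' ≤ δ z := by
    nlinarith [hnear z hz, hnear z' hz', dist_triangle_left z z' z₀]
  have hm : ‖m₀‖ₑ ≤ 2 * ‖∫ w, tent δ z w ∂μ‖ₑ :=
    hμ.enorm_integral_tent_le hδ hd₀ (hR z₀)
      (by nlinarith [hnear z hz, dist_nonneg (x := z₀) (y := z)])
  refine (hμ.edist_smoothing_le hδ (by linarith) (hR z) hzz hh 0).trans ?_
  rw [ENNReal.coe_toNNReal hK]
  simp only [sub_zero, K, div_eq_mul_inv]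
  gcongr
  · exact Measure.restrict_le_self
  · exact inv_le_two_mul_inv hm

end Smoothing

theorem exists_lipschitz_radius {X : Type*} [PseudoMetricSpace X] {Q : Set X → Prop}
    (hQ0 : Q ∅) (hQ : Antitone Q) {A : Set X} (hA : ∀ z ∈ A, ∃ s ∈ 𝓝 z, Q s) {r₀ : ℝ}
    (hr₀ : 0 < r₀) : ∃ ρ : X → ℝ, LipschitzWith 1 ρ ∧ (∀ z, ρ z ≤ r₀) ∧
      ∀ z ∈ A, 0 < ρ z ∧ Q (ball z (2 * ρ z)) := by
  let S : X → Set ℝ := fun z => {r | r ≤ r₀ ∧ Q (ball z (4 * r))}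
  have hbdd : ∀ z, BddAbove (S z) := fun z => ⟨r₀, fun r hr => hr.1⟩
  have hzero : ∀ z, 0 ∈ S z := fun z => ⟨hr₀.le, by rwa [mul_zero, ball_zero]⟩
  refine ⟨fun z => sSup (S z), LipschitzWith.of_le_add fun x y => csSup_le ⟨0, hzero x⟩ ?_,
    fun z => csSup_le ⟨0, hzero z⟩ fun r hr => hr.1, fun z hz => ?_⟩
  · intro r hr
    rw [← sub_le_iff_le_add]
    refine le_csSup (hbdd y) ⟨(sub_le_self _ dist_nonneg).trans hr.1, hQ ?_ hr.2⟩
    refine ball_subset_ball' ?_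
    linarith [dist_nonneg (x := x) (y := y), dist_comm x y]
  · obtain ⟨s, hs, hQs⟩ := hA z hz
    obtain ⟨ε, hε, hεs⟩ := Metric.mem_nhds_iff.1 hs
    have hpos : 0 < sSup (S z) := by
      refine (lt_min hr₀ (div_pos hε four_pos)).trans_le
        (le_csSup (hbdd z) ⟨min_le_left _ _, hQ ((ball_subset_ball ?_).trans hεs) hQs⟩)
      linarith [min_le_right r₀ (ε / 4)]
    obtain ⟨r, hr, hlt⟩ := exists_lt_of_lt_csSup ⟨0, hzero z⟩ (half_lt_self hpos)
    exact ⟨hpos, hQ (ball_subset_ball (by linarith)) hr.2⟩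

theorem exists_lipschitz_radius_seq {X : Type*} [PseudoMetricSpace X] {Q : Set X → Prop}
    (hQ0 : Q ∅) (hQ : Antitone Q) {A : Set X} (hA : ∀ z ∈ A, ∃ s ∈ 𝓝 z, Q s) {R : ℝ≥0∞}
    (hR : 0 < R) : ∃ δ : ℕ → X → ℝ, (∀ n, LipschitzWith 1 (δ n)) ∧
      (∀ n z, ENNReal.ofReal (2 * δ n z) ≤ R) ∧ (∀ n z, ENNReal.ofReal (δ n z) ≤ 2⁻¹ ^ n) ∧
      ∀ n, ∀ z ∈ A, 0 < δ n z ∧ Q (ball z (2 * δ n z)) := by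
  obtain ⟨r, hr, hrlt⟩ := ENNReal.lt_iff_exists_nnreal_btwn.1
    (lt_min one_pos (ENNReal.half_pos hR.ne') : 0 < min 1 (R / 2))
  rw [ENNReal.coe_pos] at hr
  choose δ hδ hδr hδA using fun n : ℕ =>
    exists_lipschitz_radius hQ0 hQ hA (r₀ := r * 2⁻¹ ^ n) (by positivity)
  have hle : ∀ n z, ENNReal.ofReal (δ n z) ≤ r * 2⁻¹ ^ n := fun n z => by
    refine (ENNReal.ofReal_le_ofReal (hδr n z)).trans_eq ?_
    rw [ENNReal.ofReal_mul r.coe_nonneg, ENNReal.ofReal_coe_nnreal,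
      ENNReal.ofReal_pow (by positivity), ENNReal.ofReal_inv_of_pos two_pos, ENNReal.ofReal_ofNat]
  refine ⟨δ, hδ, fun n z => ?_, fun n z => (hle n z).trans ?_, hδA⟩
  · calc ENNReal.ofReal (2 * δ n z) = 2 * ENNReal.ofReal (δ n z) := by
          rw [ENNReal.ofReal_mul zero_le_two, ENNReal.ofReal_ofNat]
      _ ≤ 2 * (R / 2 * 1) := by
          gcongr
          refine (hle n z).trans (mul_le_mul' (hrlt.le.trans (min_le_right _ _)) ?_)
          exact pow_le_one₀ zero_le (ENNReal.inv_le_one.2 one_le_two)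
      _ = R := by rw [mul_one, ENNReal.mul_div_cancel two_ne_zero ENNReal.ofNat_ne_top]
  · exact mul_le_of_le_one_left zero_le (hrlt.le.trans (min_le_left _ _))

section Fubini

variable {α Y : Type*} [MeasurableSpace α] [MeasurableSpace Y] {μ : Measure α} {ν : Measure Y}
  [SFinite ν]

theorem lintegral_lintegral_le_mul_measure_univ [SFinite μ] {G : α × Y → ℝ≥0∞} (hG : Measurable G)
    {c : ℝ≥0∞} (hGc : ∀ᵐ z ∂μ, ∫⁻ y, G (z, y) ∂ν ≤ c) :
    ∫⁻ y, ∫⁻ z, G (z, y) ∂μ ∂ν ≤ c * μ univ := by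
  rw [← lintegral_prod_symm' G hG, lintegral_prod G hG.aemeasurable, ← lintegral_const]
  exact lintegral_mono_ae hGc

theorem ae_tsum_lintegral_ne_top [IsFiniteMeasure μ] {G : ℕ → α × Y → ℝ≥0∞}
    (hG : ∀ n, Measurable (G n)) {c : ℕ → ℝ≥0∞} (hc : ∑' n, c n ≠ ∞)
    (hGc : ∀ n, ∀ᵐ z ∂μ, ∫⁻ y, G n (z, y) ∂ν ≤ c n) :
    ∀ᵐ y ∂ν, ∑' n, ∫⁻ z, G n (z, y) ∂μ ≠ ∞ := by
  have hGm : ∀ n, Measurable fun y => ∫⁻ z, G n (z, y) ∂μ := fun n => (hG n).lintegral_prod_left'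
  refine (ae_lt_top (Measurable.tsum hGm) ?_).mono fun y hy => hy.ne
  rw [lintegral_tsum fun n => (hGm n).aemeasurable]
  refine ne_top_of_le_ne_top ?_ (ENNReal.tsum_le_tsum fun n =>
    lintegral_lintegral_le_mul_measure_univ (hG n) (hGc n))
  rw [ENNReal.tsum_mul_right]
  finiteness

end Fubini

section SmoothedSlices

variable {X Y : Type*} [MetricSpace X] [MeasurableSpace X] [BorelSpace X] [MeasurableSpace Y]
  {μ : Measure X} {ν : Measure Y} {R : ℝ≥0∞} {β Λ τ L : ℝ≥0} {A : Set X} {H : X × Y → ℝ}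

theorem measurable_integral_tent [SecondCountableTopology X] [SFinite μ] {δ : X → ℝ}
    (hδ : Continuous δ) : Measurable fun z => ∫ w, tent δ z w ∂μ :=
  (continuous_tent hδ).measurable.stronglyMeasurable.integral_prod_right'.measurable

theorem measurable_smoothing [SecondCountableTopology X] [SFinite μ] {δ : X → ℝ}
    (hδ : Continuous δ) (hH : Measurable H) :
    Measurable fun p : X × Y => smoothing μ δ (fun w => H (w, p.2)) p.1 := by
  refine Measurable.div ?_ ((measurable_integral_tent hδ).comp measurable_fst)
  have hnum : Measurable fun q : (X × Y) × X => tent δ q.1.1 q.2 * H (q.2, q.1.2) :=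
    ((continuous_tent hδ).measurable.comp (measurable_fst.fst.prodMk measurable_snd)).mul
      (hH.comp (measurable_snd.prodMk measurable_fst.snd))
  exact hnum.stronglyMeasurable.integral_prod_right'.measurable

theorem measurable_tentOsc [SecondCountableTopology X] [SFinite μ] {δ : X → ℝ}
    (hδ : Continuous δ) (hH : Measurable H) :
    Measurable fun p : X × Y => tentOsc μ δ (fun w => H (w, p.2)) p.1 := by
  refine Measurable.div ?_ ((measurable_integral_tent hδ).enorm.comp measurable_fst)
  have hball : MeasurableSet {q : (X × Y) × X | dist q.2 q.1.1 < 2 * δ q.1.1} :=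
    measurableSet_lt (measurable_snd.dist measurable_fst.fst)
      ((hδ.measurable.comp measurable_fst.fst).const_mul 2)
  have hnum : Measurable ({q : (X × Y) × X | dist q.2 q.1.1 < 2 * δ q.1.1}.indicator
      fun q => ‖H (q.2, q.1.2) - H q.1‖ₑ) :=
    ((hH.comp (measurable_snd.prodMk measurable_fst.snd)).sub
      (hH.comp measurable_fst)).enorm.indicator hball
  convert hnum.lintegral_prod_right' (ν := μ) using 2 with p
  rw [← lintegral_indicator measurableSet_ball]
  rfl

theorem IsPIMeasure.lintegral_tentOsc_le [SFinite ν] (hμ : IsPIMeasure μ R β Λ τ) {δ : X → ℝ}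
    (hδ : Continuous δ) {z : X} (hz : 0 < δ z) (hzR : ENNReal.ofReal (2 * δ z) ≤ R)
    (hH : Measurable H) (hL : ∀ᵐ w ∂μ.restrict (ball z (2 * δ z)),
      ∫⁻ y, ‖H (w, y) - H (z, y)‖ₑ ∂ν ≤ L * edist w z) :
    ∫⁻ y, tentOsc μ δ (fun w => H (w, y)) z ∂ν ≤ 4 * β ^ 2 * L := by
  have := hμ.sigmaFinite
  have hm := hμ.integral_tent_ne_zero hδ hz hzR
  have hdiff : Measurable fun p : X × Y => ‖H p - H (z, p.2)‖ₑ :=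
    (hH.sub (hH.comp (measurable_const.prodMk measurable_snd))).enorm
  simp only [tentOsc, div_eq_mul_inv]
  rw [lintegral_mul_const' _ _ (by simpa using hm), ← div_eq_mul_inv]
  refine ENNReal.div_le_of_le_mul ?_
  calc ∫⁻ y, ∫⁻ w in ball z (2 * δ z), ‖H (w, y) - H (z, y)‖ₑ ∂μ ∂ν
      ≤ L * ENNReal.ofReal (2 * δ z) * μ (ball z (2 * δ z)) := by
        rw [← Measure.restrict_apply_univ (ball z (2 * δ z))]
        refine lintegral_lintegral_le_mul_measure_univ hdiff ?_
        filter_upwards [hL, ae_restrict_mem measurableSet_ball] with w hw hwB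
        refine hw.trans ?_
        rw [edist_dist]
        gcongr
        exact hwB.le
    _ = 2 * L * (ENNReal.ofReal (δ z) * μ (ball z (2 * δ z))) := by
        rw [ENNReal.ofReal_mul zero_le_two, ENNReal.ofReal_ofNat]
        ring
    _ ≤ 2 * L * (2 * β ^ 2 * ‖∫ w, tent δ z w ∂μ‖ₑ) := by
        exact mul_le_mul' le_rfl (hμ.mul_measure_ball_le_enorm_integral_tent hδ hz hzR)
    _ = 4 * β ^ 2 * L * ‖∫ w, tent δ z w ∂μ‖ₑ := by ring

variable {δ : ℕ → X → ℝ}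

theorem IsPIMeasure.lintegral_variation_sliceInd_le_tentOsc (hμ : IsPIMeasure μ R β Λ τ)
    (hA : IsOpen A) (hμA : μ A ≠ ∞) (hδ : ∀ n, LipschitzWith 1 (δ n))
    (hδA : ∀ n, ∀ z ∈ A, 0 < δ n z) (hδR : ∀ n z, ENNReal.ofReal (2 * δ n z) ≤ R)
    {h : X → ℝ} (hm : Measurable h) (hh : Integrable h μ)
    (hsum : ∑' n, ∫⁻ z in A, ENNReal.ofReal (δ n z) * tentOsc μ (δ n) h z ∂μ ≠ ∞) :
    ∫⁻ t, variation μ (fun x => sliceInd t (h x)) A ≤ 8 * (2 * β ^ 2 + 1) *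
      liminf (fun n => ∫⁻ z in A, tentOsc μ (δ n) h z ∂μ) atTop := by
  have := hμ.sigmaFinite
  have := hμ.secondCountableTopology
  have hK : (4 * (2 * β ^ 2 + 1) : ℝ≥0∞) ≠ ∞ := by finiteness
  have hunit : Measurable fun p : X × Unit => h p.1 := hm.comp measurable_fst
  have hsmooth : ∀ n, Measurable (smoothing μ (δ n) h) := fun n =>
    (measurable_smoothing (hδ n).continuous hunit).comp (measurable_prodMk_right (y := ()))
  have hosc : ∀ n, Measurable (tentOsc μ (δ n) h) := fun n =>
    (measurable_tentOsc (hδ n).continuous hunit).comp (measurable_prodMk_right (y := ()))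
  have hlip := fun n => hμ.locallyLipschitzOn_smoothing (hδ n) (hδA n) (hδR n) hh
  have happrox : ∑' n, ∫⁻ z in A, ‖smoothing μ (δ n) h z - h z‖ₑ ∂μ ≠ ∞ :=
    ne_top_of_le_ne_top hsum <| ENNReal.tsum_le_tsum fun n =>
      setLIntegral_mono' hA.measurableSet fun z hz =>
        hμ.enorm_smoothing_sub_le (hδ n).continuous (hδA n z hz) (hδR n z) hh
  refine (lintegral_variation_sliceInd_le hA hμA hm hsmooth hlip
    (fun n => (hosc n).const_mul (4 * (2 * β ^ 2 + 1)))
    (fun n z hz => hμ.eventually_edist_smoothing_le (hδ n) (hδA n z hz) (hδR n z) hh)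
    happrox).trans_eq ?_
  simp only [lintegral_const_mul' _ _ hK]
  rw [ENNReal.liminf_const_mul_of_ne_top hK]
  ring

theorem IsPIMeasure.lintegral_lintegral_variation_sliceInd_le [SFinite ν]
    (hμ : IsPIMeasure μ R β Λ τ) (hA : IsOpen A) (hμA : μ A ≠ ∞)
    (hδ : ∀ n, LipschitzWith 1 (δ n)) (hδA : ∀ n, ∀ z ∈ A, 0 < δ n z)
    (hδR : ∀ n z, ENNReal.ofReal (2 * δ n z) ≤ R) (hδn : ∀ n z, ENNReal.ofReal (δ n z) ≤ 2⁻¹ ^ n)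
    (hH : Measurable H) (hHi : Integrable H (μ.prod ν))
    (hL : ∀ᵐ z ∂μ.restrict A, ∀ n, ∀ᵐ w ∂μ.restrict (ball z (2 * δ n z)),
      ∫⁻ y, ‖H (w, y) - H (z, y)‖ₑ ∂ν ≤ L * edist w z) :
    ∫⁻ y, (∫⁻ t, variation μ (fun x => sliceInd t (H (x, y))) A) ∂ν
      ≤ 32 * β ^ 2 * (2 * β ^ 2 + 1) * L * μ A := by
  have := hμ.sigmaFinite
  have := hμ.secondCountableTopology
  have : Fact (μ A < ∞) := ⟨hμA.lt_top⟩
  have hosc : ∀ n, Measurable fun p : X × Y => tentOsc μ (δ n) (fun w => H (w, p.2)) p.1 :=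
    fun n => measurable_tentOsc (hδ n).continuous hH
  have hoscL : ∀ n, ∀ᵐ z ∂μ.restrict A,
      ∫⁻ y, tentOsc μ (δ n) (fun w => H (w, y)) z ∂ν ≤ 4 * β ^ 2 * L := fun n => by
    filter_upwards [hL, ae_restrict_mem hA.measurableSet] with z hz hzA
    exact hμ.lintegral_tentOsc_le (hδ n).continuous (hδA n z hzA) (hδR n z) hH (hz n)
  have hmul : ∀ n, Measurable fun p : X × Y =>
      ENNReal.ofReal (δ n p.1) * tentOsc μ (δ n) (fun w => H (w, p.2)) p.1 := fun n =>
    ((hδ n).continuous.measurable.comp measurable_fst).ennreal_ofReal.mul (hosc n)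
  have hsum : ∀ᵐ y ∂ν, ∑' n, ∫⁻ z in A,
      ENNReal.ofReal (δ n z) * tentOsc μ (δ n) (fun w => H (w, y)) z ∂μ ≠ ∞ := by
    refine ae_tsum_lintegral_ne_top (c := fun n => 2⁻¹ ^ n * (4 * β ^ 2 * L)) hmul ?_ fun n => ?_
    · rw [ENNReal.tsum_mul_right, ENNReal.tsum_geometric_two]
      finiteness
    · filter_upwards [hoscL n] with z hz
      rw [lintegral_const_mul' _ _ ENNReal.ofReal_ne_top]
      exact mul_le_mul' (hδn n z) hz
  calc ∫⁻ y, (∫⁻ t, variation μ (fun x => sliceInd t (H (x, y))) A) ∂ν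
      ≤ ∫⁻ y, 8 * (2 * β ^ 2 + 1) *
          liminf (fun n => ∫⁻ z in A, tentOsc μ (δ n) (fun w => H (w, y)) z ∂μ) atTop ∂ν := by
        refine lintegral_mono_ae ?_
        filter_upwards [hsum, hHi.prod_left_ae] with y hy hyi
        exact hμ.lintegral_variation_sliceInd_le_tentOsc hA hμA hδ hδA hδR
          (hH.comp measurable_prodMk_right) hyi hy
    _ ≤ 8 * (2 * β ^ 2 + 1) * liminf (fun n => ∫⁻ y, ∫⁻ z in A,
          tentOsc μ (δ n) (fun w => H (w, y)) z ∂μ ∂ν) atTop := by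
        rw [lintegral_const_mul' _ _ (by finiteness)]
        gcongr
        exact lintegral_liminf_le fun n => (hosc n).lintegral_prod_left'
    _ ≤ 8 * (2 * β ^ 2 + 1) * (4 * β ^ 2 * L * μ A) := by
        gcongr
        refine liminf_le_of_frequently_le' (Frequently.of_forall fun n => ?_)
        rw [← Measure.restrict_apply_univ A]
        exact lintegral_lintegral_le_mul_measure_univ (hosc n) (hoscL n)
    _ = 32 * β ^ 2 * (2 * β ^ 2 + 1) * L * μ A := by ring

end SmoothedSlices

theorem exists_measurable_integrable_isJointFunction_restrict {α Y : Type*}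
    [MeasurableSpace α] [MeasurableSpace Y] {μ : Measure α} {ν : Measure Y} [SFinite μ] [SFinite ν]
    {U : Set α} (hU : MeasurableSet U) {f : α → Lp ℝ 1 ν} (hf : MemLp f 1 (μ.restrict U)) :
    ∃ H, Measurable H ∧ Integrable H (μ.prod ν) ∧ IsJointFunction (μ.restrict U) ν f H ∧
      ∀ᵐ y ∂ν, transpose (μ.restrict U) ν f y =ᵐ[μ.restrict U] fun x => H (x, y) := by
  obtain ⟨H, hH, hHf, hHt⟩ := exists_measurable_isJointFunction hf
  have hUm : MeasurableSet (U ×ˢ univ : Set (α × Y)) := hU.prod MeasurableSet.univ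
  have hind : ∀ x ∈ U, ∀ y, (U ×ˢ univ : Set (α × Y)).indicator H (x, y) = H (x, y) :=
    fun x hx y => indicator_of_mem (mk_mem_prod hx (mem_univ y)) H
  have hHi : Integrable ((U ×ˢ univ : Set (α × Y)).indicator H) (μ.prod ν) := by
    rw [integrable_indicator_iff hUm, IntegrableOn, ← Measure.prod_restrict, Measure.restrict_univ]
    exact hHf.1
  refine ⟨_, hH.indicator hUm, hHi, ⟨?_, ?_⟩, ?_⟩
  · convert hHi.restrict (s := U ×ˢ univ) using 1
    rw [← Measure.prod_restrict, Measure.restrict_univ]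
  · filter_upwards [hHf.2, ae_restrict_mem hU] with x hx hxU
    simpa only [hind x hxU] using hx
  · filter_upwards [hHt] with y hy
    filter_upwards [hy, ae_restrict_mem hU] with x hx hxU
    rw [hx, hind x hxU]

section LipschitzToPerimeter

variable {X Y : Type*} [MetricSpace X] [MeasurableSpace X] [MeasurableSpace Y] {μ : Measure X}
  {ν : Measure Y} {U A : Set X}

theorem totalPerimeter_cutMeasure_le (hA : IsOpen A) (hAU : A ⊆ U) {f : X → Lp ℝ 1 ν}
    {H : X × Y → ℝ}
    (hH : ∀ᵐ y ∂ν, transpose (μ.restrict U) ν f y =ᵐ[μ.restrict U] fun x => H (x, y)) :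
    totalPerimeter μ U (cutMeasure (μ.restrict U) ν f) A
      ≤ ∫⁻ y, (∫⁻ t, variation μ (fun x => sliceInd t (H (x, y))) A) ∂ν := by
  refine (lintegral_cutMeasure_le f _).trans (lintegral_mono_ae ?_)
  filter_upwards [hH] with y hy
  refine lintegral_mono fun t => ?_
  rw [perimeterMeasure_of_isOpen hA hAU]
  refine (variation_congr_ae ?_).le
  filter_upwards [ae_restrict_of_ae_restrict_of_subset hAU
    (slice_coe_ae_eq (transpose (μ.restrict U) ν f y) t),
    ae_restrict_of_ae_restrict_of_subset hAU hy] with x hslice hx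
  rw [hslice, hx]

theorem IsPIMeasure.totalPerimeter_le_of_lipschitz [BorelSpace X] [SFinite ν] {R : ℝ≥0∞}
    {β Λ τ L : ℝ≥0} (hμ : IsPIMeasure μ R β Λ τ) (hR : 0 < R) (hU : IsOpen U)
    {f F : X → Lp ℝ 1 ν} (hf : MemLp f 1 (μ.restrict U)) (hFf : F =ᵐ[μ.restrict U] f)
    (hF : ∀ x ∈ U, ∃ s ∈ 𝓝 x, LipschitzOnWith L F s) (hA : IsOpen A) (hAU : A ⊆ U)
    (hμA : μ A ≠ ∞) :
    totalPerimeter μ U (cutMeasure (μ.restrict U) ν f) A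
      ≤ 32 * β ^ 2 * (2 * β ^ 2 + 1) * L * μ A := by
  have := hμ.sigmaFinite
  obtain ⟨H, hH, hHi, hHf, hHt⟩ :=
    exists_measurable_integrable_isJointFunction_restrict hU.measurableSet hf
  obtain ⟨δ, hδ, hδR, hδn, hδA⟩ := exists_lipschitz_radius_seq
    (Q := fun s => s ⊆ A ∧ LipschitzOnWith L F s) ⟨empty_subset A, by simp⟩
    (fun s t hst ht => ⟨hst.trans ht.1, ht.2.mono hst⟩) (A := A) (fun z hz => by
      obtain ⟨s, hs, hFs⟩ := hF z (hAU hz)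
      exact ⟨s ∩ A, inter_mem hs (hA.mem_nhds hz), inter_subset_right,
        hFs.mono inter_subset_left⟩) hR
  have hHF : ∀ᵐ z ∂μ.restrict U, (fun y => H (z, y)) =ᵐ[ν] F z := (hHf.congr_ae hFf.symm).2
  have hHL : ∀ᵐ z ∂μ.restrict A, ∀ n, ∀ᵐ w ∂μ.restrict (ball z (2 * δ n z)),
      ∫⁻ y, ‖H (w, y) - H (z, y)‖ₑ ∂ν ≤ L * edist w z := by
    filter_upwards [ae_restrict_of_ae_restrict_of_subset hAU hHF,
      ae_restrict_mem hA.measurableSet] with z hz hzA n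
    obtain ⟨hpos, hball, hFball⟩ := hδA n z hzA
    filter_upwards [ae_restrict_of_ae_restrict_of_subset (hball.trans hAU) hHF,
      ae_restrict_mem measurableSet_ball] with w hw hwB
    rw [← edist_Lp_one_of_ae_eq hw hz]
    exact hFball hwB (mem_ball_self (by positivity))
  exact (totalPerimeter_cutMeasure_le hA hAU hHt).trans <|
    hμ.lintegral_lintegral_variation_sliceInd_le hA hμA hδ (fun n z hz => (hδA n z hz).1) hδR hδn
      hH hHi hHL

end LipschitzToPerimeter

theorem lipschitzOnWith_of_exists_eVariationOn_le {X E : Type*} [PseudoEMetricSpace X]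
    [PseudoEMetricSpace E] {U : Set X} {F : X → E} {K Q : ℝ≥0}
    (hF : ∀ γ : ℝ → X, ContinuousOn γ (Icc 0 1) → MapsTo γ (Icc 0 1) U →
      edist (F (γ 0)) (F (γ 1)) ≤ K * eVariationOn γ (Icc 0 1))
    (hQ : ∀ x ∈ U, ∀ y ∈ U, ∃ γ : ℝ → X, ContinuousOn γ (Icc 0 1) ∧ MapsTo γ (Icc 0 1) U ∧
      γ 0 = x ∧ γ 1 = y ∧ eVariationOn γ (Icc 0 1) ≤ Q * edist x y) :
    LipschitzOnWith (K * Q) F U := by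
  intro x hx y hy
  obtain ⟨γ, hγ, hγU, rfl, rfl, hlength⟩ := hQ x hx y hy
  calc edist (F (γ 0)) (F (γ 1)) ≤ K * eVariationOn γ (Icc 0 1) := hF γ hγ hγU
    _ ≤ K * (Q * edist (γ 0) (γ 1)) := by gcongr
    _ = (K * Q : ℝ≥0) * edist (γ 0) (γ 1) := by rw [ENNReal.coe_mul, mul_assoc]

end TotalPerimeter

theorem mainTheorem9_general (β Λ τ : ℝ≥0) :
    ∃ C : ℝ≥0, ∀ (X : Type*) [MetricSpace X] [MeasurableSpace X] [BorelSpace X]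
      (μ : Measure X) (R : ℝ≥0∞), 0 < R → TotalPerimeter.IsPIMeasure μ R β Λ τ →
      ∀ (Y : Type*) [MeasurableSpace Y] (ν : Measure Y) [SFinite ν] (U : Set X), IsOpen U →
      ∀ f : X → Lp ℝ 1 ν, MemLp f 1 (μ.restrict U) → ∀ L : ℝ≥0,
        ((∃ F : X → Lp ℝ 1 ν, F =ᵐ[μ.restrict U] f ∧
            ∀ x ∈ U, ∃ s ∈ 𝓝 x, LipschitzOnWith L F s) →
          ∀ (x : X) (r : ℝ), 0 < r →
            TotalPerimeter.totalPerimeter μ U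
                (TotalPerimeter.cutMeasure (μ.restrict U) ν f) (ball x r ∩ U)
              ≤ C * L * μ (ball x r ∩ U)) ∧
        ((∀ (x : X) (r : ℝ), 0 < r → ball x r ⊆ U →
            TotalPerimeter.totalPerimeter μ U
                (TotalPerimeter.cutMeasure (μ.restrict U) ν f) (ball x r)
              ≤ L * μ (ball x r)) →
          ∃ F : X → Lp ℝ 1 ν, F =ᵐ[μ.restrict U] f ∧
            (∀ x ∈ U, ∀ y ∈ U, C * edist x y ≤ R → ball x (C * dist x y) ⊆ U →
              edist (F x) (F y) ≤ C * L * edist x y) ∧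
            (∀ γ : ℝ → X, ContinuousOn γ (Icc 0 1) → MapsTo γ (Icc 0 1) U →
              edist (F (γ 0)) (F (γ 1)) ≤ C * L * eVariationOn γ (Icc 0 1)) ∧
            (∀ Q : ℝ≥0, (∀ x ∈ U, ∀ y ∈ U, ∃ γ : ℝ → X, ContinuousOn γ (Icc 0 1) ∧
                MapsTo γ (Icc 0 1) U ∧ γ 0 = x ∧ γ 1 = y ∧
                eVariationOn γ (Icc 0 1) ≤ Q * edist x y) →
              LipschitzOnWith (C * L * Q) F U) ∧
            (U = univ → R = ∞ → LipschitzWith (C * L) F)) := by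
  obtain ⟨k, hΛk⟩ := pow_unbounded_of_one_lt Λ one_lt_two
  have hΛk' : Λ < 2 ^ (k + 1) := hΛk.trans_le (pow_le_pow_right₀ one_le_two k.le_succ)
  obtain ⟨C, hC⟩ : BddAbove {4 * 2 ^ (k + 1), 32 * (τ + 1) * β ^ (k + 1 + 4),
    32 * β ^ 2 * (2 * β ^ 2 + 1)} := Set.Finite.bddAbove (by simp)
  simp only [mem_upperBounds, mem_insert_iff, mem_singleton_iff, forall_eq_or_imp, forall_eq] at hC
  obtain ⟨hkC, hβC, hperim⟩ := hC
  refine ⟨C, fun X _ _ _ μ R hR hμ Y _ ν _ U hU f hf L => ⟨?_, fun hL => ?_⟩⟩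
  · rintro ⟨F, hFf, hF⟩ x r -
    have hfin : μ (ball x r ∩ U) ≠ ∞ :=
      measure_ne_top_of_subset inter_subset_left (hμ.ball_lt_top x r).ne
    refine (hμ.totalPerimeter_le_of_lipschitz hR hU hf hFf hF (isOpen_ball.inter hU)
      inter_subset_right hfin).trans ?_
    gcongr
    exact_mod_cast hperim
  · obtain ⟨F, hFf, hF⟩ :=
      hμ.exists_lipschitz_of_totalPerimeter_le hR hU hf hL k.succ_pos hΛk' hkC hβC
    have hcurve : ∀ γ : ℝ → X, ContinuousOn γ (Icc 0 1) → MapsTo γ (Icc 0 1) U →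
        edist (F (γ 0)) (F (γ 1)) ≤ C * L * eVariationOn γ (Icc 0 1) := fun γ hγ hγU =>
      TotalPerimeter.edist_le_mul_eVariationOn_of_ball_subset hU hR hF zero_le_one hγ hγU
    refine ⟨F, hFf, hF, hcurve, fun Q hQ => ?_, ?_⟩
    · exact TotalPerimeter.lipschitzOnWith_of_exists_eVariationOn_le (by simpa using hcurve) hQ
    · rintro rfl rfl x y
      simpa using hF x (mem_univ x) y (mem_univ y) le_top (subset_univ _)

theorem mainTheorem9 (β Λ τ : ℝ≥0) (hΛ : 1 ≤ Λ) :
    ∃ C : ℝ≥0, ∀ (X : Type*) [MetricSpace X] [CompleteSpace X] [MeasurableSpace X] [BorelSpace X]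
      (μ : Measure X) (R : ℝ≥0∞), 0 < R → TotalPerimeter.IsPIMeasure μ R β Λ τ →
      ∀ (Y : Type*) [MeasurableSpace Y] (ν : Measure Y) [SigmaFinite ν]
        (U : Set X), IsOpen U →
      ∀ f : X → Lp ℝ 1 ν, TotalPerimeter.IsBV μ U f →
      ∀ L : ℝ≥0,
        -- a (locally) `L`-Lipschitz representative forces the bound on all balls
        ((∃ F : X → Lp ℝ 1 ν, F =ᵐ[μ.restrict U] f ∧
            ∀ x ∈ U, ∃ s ∈ 𝓝 x, LipschitzOnWith L F s) →
          ∀ (x : X) (r : ℝ), 0 < r →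
            TotalPerimeter.totalPerimeter μ U
                (TotalPerimeter.cutMeasure (μ.restrict U) ν f) (ball x r ∩ U)
              ≤ C * L * μ (ball x r ∩ U)) ∧
        -- the bound on all balls contained in `U` gives a Lipschitz representative
        ((∀ (x : X) (r : ℝ), 0 < r → ball x r ⊆ U →
            TotalPerimeter.totalPerimeter μ U
                (TotalPerimeter.cutMeasure (μ.restrict U) ν f) (ball x r)
              ≤ L * μ (ball x r)) →
          ∃ F : X → Lp ℝ 1 ν, F =ᵐ[μ.restrict U] f ∧
            -- at distances comparable with the distance to the complement of `U`
            (∀ x ∈ U, ∀ y ∈ U, C * edist x y ≤ R → ball x (C * dist x y) ⊆ U →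
              edist (F x) (F y) ≤ C * L * edist x y) ∧
            -- with respect to the inner length distance of `U`
            (∀ γ : ℝ → X, ContinuousOn γ (Icc 0 1) → MapsTo γ (Icc 0 1) U →
              edist (F (γ 0)) (F (γ 1)) ≤ C * L * eVariationOn γ (Icc 0 1)) ∧
            -- on all of `U`, if `U` is quasiconvex
            (∀ Q : ℝ≥0, (∀ x ∈ U, ∀ y ∈ U, ∃ γ : ℝ → X, ContinuousOn γ (Icc 0 1) ∧
                MapsTo γ (Icc 0 1) U ∧ γ 0 = x ∧ γ 1 = y ∧
                eVariationOn γ (Icc 0 1) ≤ Q * edist x y) →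
              LipschitzOnWith (C * L * Q) F U) ∧
            -- on all of `X`, if `U = X` and the PI conditions hold at all scales
            (U = univ → R = ∞ → LipschitzWith (C * L) F)) := by
  obtain ⟨C, hC⟩ := mainTheorem9_general β Λ τ
  exact ⟨C, fun X _ _ _ _ μ R hR hμ Y _ ν _ U hU f hf L => hC X μ R hR hμ Y ν U hU f hf.1 L⟩
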